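/- **Setting.** Let $M=(X,A,Z,T_r,O,c,\gamma)$ be a POMDP with measurable state space $X$, finite nonempty action set $A$, measurable observation space $Z$, transition kernels $T_r(\cdot\mid x,a)$, observation densities $O(z\mid a,x')$ with respect to a $\sigma$-finite measure on $Z$, measurable state cost $c(x,a)\in[R_{\min},R_{\max}]$, and discount factor $\gamma\in[0,1]$. Fix $N_p\in\mathbb N$ and let $\Sigma$ be the set of particle beliefs $\bar b=\{(x_i,w_i)\}_{i=1}^{N_p}$ with $x_i\in X$, $w_i\ge 0$ and some $w_i>0$. The particle belief MDP $M_P$ has state space $\Sigma$, cost $\rho(\bar b,a)=\sum_i w_ic(x_i,a)/\sum_i w_i$, and transition law $\tau(\cdot\mid\bar b,a)$ given by the particle filter step: draw $x_0=x_i$ with probability $w_i/\sum_j w_j$, draw $x_0'\sim T_r(\cdot\mid x_0,a)$ and $z\sim O(\cdot\mid a,x_0')$; independently draw $x_i'\sim T_r(\cdot\mid x_i,a)$ for each $i$; put $w_i'=w_i\,O(z\mid a,x_i')$ and $\bar b'=\{(x_i',w_i')\}_{i=1}^{N_p}$. It is assumed that $\bar b'\in\Sigma$ almost surely, for all $\bar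 b\in\Sigma$ and $a\in A$. Let $\alpha\in(0,1]$, let $CVaR_\alpha(Y)=\inf_{w\in\mathbb R}\{w+\frac1\alpha\mathbb E[(Y-w)^+]\}$, and let $\hat C_\alpha(y_1,\dots,y_n)=\inf_{r\in\mathbb R}\{r+\frac1{n\alpha}\sum_{i=1}^n(y_i-r)^+\}$. For a horizon $T\in\mathbb N$ the optimal ICVaR value function is given by $V^*_{t}(\bar b)=0$ for $t>T$ and, for $t\le T$, $$V^*_t(\bar b)=\min_{a\in A}\Big(\rho(\bar b,a)+\gamma\,CVaR_\alpha\big[V^*_{t+1}(\bar b')\big]\Big),\qquad \bar b'\sim\tau(\cdot\mid\bar b,a).$$ ICVaR Sparse Sampling with branching factor $N_b$ returns the random estimate $\hat V^*_t(\bar b)$, where $\hat V^*_t(\bar b)=0$ for $t>T$ and, for $t\le T$, $$\hat V^*_t(\bar b)=\min_{a\in A}\Big(\rho(\bar b,a)+\gamma\,\hat C_\alpha\big(\hat V^*_{t+1}(\bar b'_{a,1}),\dots,\hat V^*_{t+1}(\bar b'_{a,N_b})\big)\Big);$$ here the $\bar b'_{a,i}\sim\tau(\cdot\mid\bar b,a)$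 are drawn independently for all $a\in A$ and $i\le N_b$, and the recursive calls use independent fresh randomness. **Theorem.** Let $\delta\in(0,1)$, $0\le t\le T$, $\bar b_t\in\Sigma$, $\Delta R=R_{\max}-R_{\min}$, $T_{\alpha,t}=\sum_{k=0}^{T-t-1}\frac{T-t-k}{\alpha^k}$ and $T'_{\alpha,t}=\sum_{j=0}^{T-t-1}\frac{T-t+1-j}{\alpha^j}$ (so that for $t=T$ both sums are $0$ and all bounds below read as $0$). If $N_b>1$, then $$P\Bigg(V^*_t(\bar b_t)-\hat V^*_t(\bar b_t)\le\gamma\,\Delta R\;T_{\alpha,t}\sqrt{\frac{5\ln\big(\frac{3|A|((|A|N_b)^{T-t}-1)}{\delta(|A|N_b-1)}\big)}{\alpha N_b}}\Bigg)\ge1-\delta$$ and $$P\Bigg(V^*_t(\bar b_t)-\hat V^*_t(\bar b_t)\ge-\frac{\gamma\,\Delta R}{\alpha}\sqrt{\frac{\ln\big(\frac{|A|((|A|N_b)^{T-t}-1)}{\delta(|A|N_b-1)}\big)}{2N_b}}\;T'_{\alpha,t}\Bigg)\ge1-\delta.$$ If $N_b=1$, then $$P\Bigg(V^*_t(\bar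 b_t)-\hat V^*_t(\bar b_t)\le\gamma\,\Delta R\;T_{\alpha,t}\sqrt{\frac{5\ln\big(\frac{3|A|^{T-t}(T-t)}{\delta}\big)}{\alpha}}\Bigg)\ge1-\delta$$ and $$P\Bigg(V^*_t(\bar b_t)-\hat V^*_t(\bar b_t)\ge-\frac{\gamma\,\Delta R}{\alpha}\sqrt{\frac{\ln\big(\frac{|A|^{T-t}(T-t)}{\delta}\big)}{2}}\;T'_{\alpha,t}\Bigg)\ge1-\delta.$$ -/

import Mathlib

open MeasureTheory ProbabilityTheory
open scoped NNReal ENNReal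

namespace ICVaR

/-! ### Conditional value at risk -/

/-- `CVaR_α` of the random variable `f` under the law `μ`:
`inf_w { w + α⁻¹ E[(f - w)⁺] }`. -/
noncomputable def cvar {S : Type*} [MeasurableSpace S] (α : ℝ) (μ : Measure S) (f : S → ℝ) : ℝ :=
  ⨅ w : ℝ, (w + 1 / α * ∫ s, max (f s - w) 0 ∂μ)

/-- The empirical estimator `Ĉ_α(y₁, …, yₙ) = inf_r { r + (nα)⁻¹ ∑ (yᵢ - r)⁺ }`. -/
noncomputable def empCVaR {n : ℕ} (α : ℝ) (y : Fin n → ℝ) : ℝ :=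
  ⨅ r : ℝ, (r + 1 / ((n : ℝ) * α) * ∑ i, max (y i - r) 0)

/-! ### Markov decision processes, optimal ICVaR value function, sparse sampling -/

/-- The data of an MDP with costs: transition kernels, cost function, discount factor. -/
structure MDP (S A : Type*) [MeasurableSpace S] where
  τ : A → Kernel S S
  ρ : S → A → ℝ
  γ : ℝ

namespace MDP

variable {S A : Type*} [MeasurableSpace S] [Fintype A] [Nonempty A]

/-- Optimal ICVaR value with `n` decision stages to go: it is `0` if `n = 0`, and otherwise
`min_a Q(s, a)` with `Q(s, a) = ρ(s, a) + γ CVaR_α[V(s')]`, `s' ∼ τ(· | s, a)`, where `V` is the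
optimal value with one stage less. -/
noncomputable def optValueToGo (M : MDP S A) (α : ℝ) : ℕ → S → ℝ
  | 0, _ => 0
  | n + 1, s => Finset.univ.inf' Finset.univ_nonempty
      fun a : A => M.ρ s a + M.γ * cvar α (M.τ a s) (optValueToGo M α n)

/-- The optimal ICVaR value function `V*_t` for horizon `T`. The stages are `t, t + 1, …, T`, and
`V*_t = 0` for `t > T`. -/
noncomputable def optValue (M : MDP S A) (α : ℝ) (T t : ℕ) (s : S) : ℝ :=
  M.optValueToGo α (T + 1 - t) s

/-- The law of the random number that sparse sampling returns at `s` with `n` stages to go.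
For every action `a`, independently, it draws `Nb` independent successors `s'ᵢ ∼ τ(· | s, a)`,
runs itself with fresh randomness on each of them (so each returned value has the law
`(M.τ a s).bind (…)`), and forms `Q̂(a) = ρ(s, a) + γ Ĉ_α(returned values)`;
it returns `min_a Q̂(a)`. -/
noncomputable def sparseSamplingToGo (M : MDP S A) (α : ℝ) (Nb : ℕ) : ℕ → S → Measure ℝ
  | 0, _ => Measure.dirac 0
  | n + 1, s =>
      (Measure.pi fun a : A =>
        (Measure.pi fun _ : Fin Nb => (M.τ a s).bind (sparseSamplingToGo M α Nb n)).map
          fun v => M.ρ s a + M.γ * empCVaR α v).map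
      fun q => Finset.univ.inf' Finset.univ_nonempty q

/-- The law of the estimate `V̂*_t` returned by sparse sampling at time `t` for horizon `T`. -/
noncomputable def sparseSampling (M : MDP S A) (α : ℝ) (Nb T t : ℕ) (s : S) : Measure ℝ :=
  M.sparseSamplingToGo α Nb (T + 1 - t) s

end MDP

/-! ### POMDPs and particle belief MDPs -/

/-- A POMDP (the initial belief plays no role here). The observation model is given by
densities `obsDens a x' z` of the observation `z`, given that the action `a` led to the state `x'`,
with respect to a reference measure (Lebesgue measure, counting measure, …). -/
structure POMDP (X A Z : Type*) [MeasurableSpace X] [MeasurableSpace Z] where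
  trans : A → Kernel X X
  markov_trans : ∀ a, IsMarkovKernel (trans a)
  obsRef : Measure Z
  sigmaFinite_obsRef : SigmaFinite obsRef
  obsDens : A → X → Z → ℝ≥0
  measurable_obsDens : ∀ a, Measurable fun p : X × Z => obsDens a p.1 p.2
  lintegral_obsDens : ∀ a x, ∫⁻ z, (obsDens a x z : ℝ≥0∞) ∂obsRef = 1
  cost : X → A → ℝ
  measurable_cost : ∀ a, Measurable fun x => cost x a
  γ : ℝ

/-- Particle beliefs `{(xᵢ, wᵢ)}`, `i = 1, …, Np`, with `wᵢ ≥ 0` and some `wᵢ > 0`. -/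
abbrev ParticleBelief (X : Type*) (Np : ℕ) : Type _ :=
  {b : Fin Np → X × ℝ≥0 // ∃ i, 0 < (b i).2}

namespace POMDP

variable {X A Z : Type*} [MeasurableSpace X] [MeasurableSpace Z] {Np : ℕ}

/-- The law of a state drawn from the particle belief: `xᵢ` with probability `wᵢ / ∑ⱼ wⱼ`. -/
noncomputable def drawParticle (b : ParticleBelief X Np) : Measure X :=
  ∑ i, (((b.1 i).2 / ∑ j, (b.1 j).2 : ℝ≥0) : ℝ≥0∞) • Measure.dirac (b.1 i).1

/-- The law of the observation `z` generated from a state drawn from the particle belief. -/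
noncomputable def obsLaw (M : POMDP X A Z) (a : A) (b : ParticleBelief X Np) : Measure Z :=
  ((drawParticle b).bind (M.trans a)).bind
    fun x' => M.obsRef.withDensity fun z => (M.obsDens a x' z : ℝ≥0∞)

/-- The law of the output of the particle filter step: draw `z` from `obsLaw`, independently
move every particle, `x'ᵢ ∼ trans(· | xᵢ, a)`, and put `w'ᵢ = wᵢ · obsDens(z | a, x'ᵢ)`. -/
noncomputable def genPF (M : POMDP X A Z) (a : A) (b : ParticleBelief X Np) :
    Measure (Fin Np → X × ℝ≥0) :=
  ((M.obsLaw a b).prod (Measure.pi fun i => M.trans a (b.1 i).1)).map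
    fun p i => (p.2 i, (b.1 i).2 * M.obsDens a (p.2 i) p.1)

theorem measurable_pi_measure {S ι E : Type*} [MeasurableSpace S] [Fintype ι] [MeasurableSpace E]
    {κ : ι → S → Measure E} (hκ : ∀ i, Measurable (κ i))
    (hp : ∀ i s, IsProbabilityMeasure (κ i s)) :
    Measurable fun s => Measure.pi fun i => κ i s := by
  have := hp
  refine Measurable.measure_of_isPiSystem_of_isProbabilityMeasure
    generateFrom_pi.symm isPiSystem_pi ?_
  rintro _ ⟨t, ht, rfl⟩
  simp only [Measure.pi_pi]
  exact Finset.measurable_prod _ fun i _ =>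
    (Measure.measurable_coe (ht i (Set.mem_univ i))).comp (hκ i)

theorem isProbabilityMeasure_drawParticle (b : ParticleBelief X Np) :
    IsProbabilityMeasure (drawParticle b) := by
  constructor
  have h : (∑ j, (b.1 j).2) ≠ 0 := by
    obtain ⟨i, hi⟩ := b.2
    exact (hi.trans_le (Finset.single_le_sum (f := fun j => (b.1 j).2)
      (fun _ _ => zero_le) (Finset.mem_univ i))).ne'
  have h1 : ∑ i, (b.1 i).2 / ∑ j, (b.1 j).2 = 1 := by
    rw [← Finset.sum_div, div_self h]
  simp only [drawParticle, Measure.finsetSum_apply, Measure.smul_apply, smul_eq_mul,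
    measure_univ, mul_one]
  exact_mod_cast h1

theorem measurable_drawParticle :
    Measurable fun b : ParticleBelief X Np => drawParticle b := by
  have hw : ∀ i, Measurable fun b : ParticleBelief X Np => (b.1 i).2 := fun i =>
    measurable_snd.comp ((measurable_pi_apply i).comp measurable_subtype_coe)
  have hx : ∀ i, Measurable fun b : ParticleBelief X Np => (b.1 i).1 := fun i =>
    measurable_fst.comp ((measurable_pi_apply i).comp measurable_subtype_coe)
  refine Measure.measurable_of_measurable_coe _ fun s hs => ?_
  simp only [drawParticle, Measure.finsetSum_apply, Measure.smul_apply, smul_eq_mul]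
  refine Finset.measurable_sum _ fun i _ => Measurable.mul ?_ ?_
  · exact ((hw i).div (Finset.measurable_sum _ fun j _ => hw j)).coe_nnreal_ennreal
  · exact (Measure.measurable_coe hs).comp (Measure.measurable_dirac.comp (hx i))

theorem measurable_obsModel (M : POMDP X A Z) (a : A) :
    Measurable fun x' => M.obsRef.withDensity fun z => (M.obsDens a x' z : ℝ≥0∞) := by
  have := M.sigmaFinite_obsRef
  refine Measure.measurable_of_measurable_coe _ fun s hs => ?_
  simp only [withDensity_apply _ hs]
  exact (M.measurable_obsDens a).coe_nnreal_ennreal.lintegral_prod_right'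

theorem isProbabilityMeasure_obsLaw (M : POMDP X A Z) (a : A) (b : ParticleBelief X Np) :
    IsProbabilityMeasure (M.obsLaw a b) := by
  have := isProbabilityMeasure_drawParticle b
  have := M.markov_trans a
  have h : ∀ x', IsProbabilityMeasure
      (M.obsRef.withDensity fun z => (M.obsDens a x' z : ℝ≥0∞)) := fun x' =>
    ⟨by rw [withDensity_apply _ MeasurableSet.univ, Measure.restrict_univ,
      M.lintegral_obsDens a x']⟩
  have h1 : IsProbabilityMeasure ((drawParticle b).bind (M.trans a)) :=
    isProbabilityMeasure_bind (M.trans a).measurable.aemeasurable (.of_forall fun _ => inferInstance)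
  exact isProbabilityMeasure_bind (M.measurable_obsModel a).aemeasurable (.of_forall h)

theorem measurable_obsLaw (M : POMDP X A Z) (a : A) :
    Measurable fun b : ParticleBelief X Np => M.obsLaw a b :=
  (Measure.measurable_bind' (M.measurable_obsModel a)).comp
    ((Measure.measurable_bind' (M.trans a).measurable).comp measurable_drawParticle)

theorem measurable_genPF (M : POMDP X A Z) (a : A) :
    Measurable fun b : ParticleBelief X Np => M.genPF a b := by
  have := M.markov_trans a
  have hobs := fun b : ParticleBelief X Np => M.isProbabilityMeasure_obsLaw a b
  have hw : ∀ i, Measurable fun b : ParticleBelief X Np => (b.1 i).2 := fun i =>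
    measurable_snd.comp ((measurable_pi_apply i).comp measurable_subtype_coe)
  have hx : ∀ i, Measurable fun b : ParticleBelief X Np => (b.1 i).1 := fun i =>
    measurable_fst.comp ((measurable_pi_apply i).comp measurable_subtype_coe)
  let κ : Kernel (ParticleBelief X Np) Z := ⟨fun b => M.obsLaw a b, M.measurable_obsLaw a⟩
  let η : Kernel (ParticleBelief X Np) (Fin Np → X) :=
    ⟨fun b => Measure.pi fun i => M.trans a (b.1 i).1,
      measurable_pi_measure (fun i => (M.trans a).measurable.comp (hx i))
        fun _ _ => inferInstance⟩
  have hκ : IsMarkovKernel κ := ⟨hobs⟩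
  have hη : IsMarkovKernel η :=
    ⟨fun b => inferInstanceAs (IsProbabilityMeasure (Measure.pi fun i => M.trans a (b.1 i).1))⟩
  have hF : Measurable fun (q : ParticleBelief X Np × Z × (Fin Np → X)) (i : Fin Np) =>
      (q.2.2 i, (q.1.1 i).2 * M.obsDens a (q.2.2 i) q.2.1) := by
    refine measurable_pi_lambda _ fun i => ?_
    have h2 : Measurable fun q : ParticleBelief X Np × Z × (Fin Np → X) => q.2.2 i :=
      (measurable_pi_apply i).comp (measurable_snd.comp measurable_snd)
    exact h2.prodMk (((hw i).comp measurable_fst).mul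
      ((M.measurable_obsDens a).comp (h2.prodMk (measurable_fst.comp measurable_snd))))
  refine Measure.measurable_of_measurable_coe _ fun s hs => ?_
  have hrew : ∀ b : ParticleBelief X Np, M.genPF a b s = (κ ×ₖ η) b (Prod.mk b ⁻¹'
      ((fun (q : ParticleBelief X Np × Z × (Fin Np → X)) (i : Fin Np) =>
        (q.2.2 i, (q.1.1 i).2 * M.obsDens a (q.2.2 i) q.2.1)) ⁻¹' s)) := by
    intro b
    rw [Kernel.prod_apply]
    exact Measure.map_apply (hF.comp measurable_prodMk_left) hs
  simp only [hrew]
  exact Kernel.measurable_kernel_prodMk_left (hF hs)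

theorem measurableSet_particleBelief :
    MeasurableSet {b : Fin Np → X × ℝ≥0 | ∃ i, 0 < (b i).2} := by
  simp only [Set.ofPred_exists]
  exact MeasurableSet.iUnion fun i =>
    measurableSet_lt measurable_const (measurable_snd.comp (measurable_pi_apply i))

/-- The particle belief MDP of a POMDP with `Np` particles. Its transition law is that of the
particle filter step, regarded as a measure on the set of particle beliefs; its cost is the
weighted mean cost of the particles. -/
noncomputable def particleMDP (M : POMDP X A Z) (Np : ℕ) : MDP (ParticleBelief X Np) A where
  τ a := Kernel.comapRight ⟨fun b => M.genPF a b, M.measurable_genPF a⟩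
    (MeasurableEmbedding.subtype_coe measurableSet_particleBelief)
  ρ b a := (∑ i, ((b.1 i).2 : ℝ) * M.cost (b.1 i).1 a) / ∑ i, ((b.1 i).2 : ℝ)
  γ := M.γ

end POMDP

end ICVaR

namespace ICVaR

/-! ### Basic properties of the conditional value at risk -/

section CVaR

variable {S : Type*} [MeasurableSpace S] {μ : Measure S} {α : ℝ} {f g : S → ℝ}

/-! Three facts carry the proof. First, `empCVaR` is the `CVaR` of the uniform law on the sample
(`empCVaR_eq_cvar`), so it is monotone and commutes with adding constants: one-sided errors of the
recursive calls pass through it, and through the minimum over actions, without growing. In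
particular no factor `1 / α` accumulates from stage to stage. Second, the optimal value with `n`
stages to go ranges over an interval of length `n * (Rmax - Rmin)`. Third, for a fixed bounded
function the estimator concentrates around `CVaR`.

For the third fact, let `v` be an upper `α`-quantile and `D` the randomized indicator of the upper
tail, of mass exactly `α` (`exists_tail_weight`). Overestimation: testing the empirical infimum at
`v` leaves a mean of bounded variables, and Hoeffding applies. Underestimation: using `D` as dual
weights on the sample bounds the empirical infimum below by the smaller of two sample means
(`min_le_empCVaR`). Their summands, after rescaling, lie in `[0, 1]` with mean at most `α`, so the
variance is at most `α` too. A Bernstein-type bound then gives the rate `√(L / (α * n))` in place of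
`√(L / n) / α`.

Coupling each returned value with the successor it was computed from gives the recursion
(`IsBounded.measure_error_succ_le`): the error goes from `E` to `γ * (E + C)` and the failure
probability from `p` to `|A| * (q + Nb * p)`. The final stage is exact, so with `m + 1` stages to go
the error is at most `γ * (Rmax - Rmin) * c * (1 + ⋯ + m)`, with failure probability `q` times a
geometric sum in `|A| * Nb`. As `1 / α ^ k ≥ 1`, the weighted sums of the theorem dominate `1 + ⋯ +
m`. -/

theorem integrable_posPart_sub [IsFiniteMeasure μ] (hf : Integrable f μ) (w : ℝ) :
    Integrable (fun s => max (f s - w) 0) μ :=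
  (hf.sub (integrable_const w)).pos_part

/-- As `1 / α ≥ 1`, the objective dominates `w + E[f - w]`. This supplies the lower bound without
which the real infimum would be a default value. -/
theorem integral_le_cvar_objective [IsProbabilityMeasure μ] (hα₀ : 0 < α) (hα₁ : α ≤ 1)
    (hf : Integrable f μ) (w : ℝ) :
    ∫ s, f s ∂μ ≤ w + 1 / α * ∫ s, max (f s - w) 0 ∂μ := by
  have h1 : ∫ s, (f s - w) ∂μ ≤ ∫ s, max (f s - w) 0 ∂μ :=
    integral_mono (hf.sub (integrable_const w)) (integrable_posPart_sub hf w)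
      fun s => le_max_left _ _
  have h2 : 0 ≤ ∫ s, max (f s - w) 0 ∂μ := integral_nonneg fun s => le_max_right _ _
  have h3 : 1 ≤ 1 / α := by rw [le_div_iff₀ hα₀]; linarith
  rw [integral_sub hf (integrable_const w)] at h1
  simp only [integral_const, probReal_univ, one_smul] at h1
  nlinarith

theorem bddBelow_cvar_objective [IsProbabilityMeasure μ] (hα₀ : 0 < α) (hα₁ : α ≤ 1)
    (hf : Integrable f μ) :
    BddBelow (Set.range fun w : ℝ => w + 1 / α * ∫ s, max (f s - w) 0 ∂μ) :=
  ⟨_, Set.forall_mem_range.2 (integral_le_cvar_objective hα₀ hα₁ hf)⟩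

theorem cvar_le_objective [IsProbabilityMeasure μ] (hα₀ : 0 < α) (hα₁ : α ≤ 1)
    (hf : Integrable f μ) (w : ℝ) :
    cvar α μ f ≤ w + 1 / α * ∫ s, max (f s - w) 0 ∂μ :=
  ciInf_le (bddBelow_cvar_objective hα₀ hα₁ hf) w

/-- Monotonicity and translation invariance of `CVaR`. -/
theorem cvar_le_cvar_add [IsProbabilityMeasure μ] (hα₀ : 0 < α) (hα₁ : α ≤ 1)
    (hf : Integrable f μ) (hg : Integrable g μ) (c : ℝ) (hfg : ∀ s, f s ≤ g s + c) :
    cvar α μ f ≤ cvar α μ g + c := by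
  rw [← sub_le_iff_le_add]
  refine le_ciInf fun w => ?_
  have h1 := cvar_le_objective hα₀ hα₁ hf (w + c)
  have h2 : ∫ s, max (f s - (w + c)) 0 ∂μ ≤ ∫ s, max (g s - w) 0 ∂μ :=
    integral_mono (integrable_posPart_sub hf _) (integrable_posPart_sub hg _)
      fun s => max_le_max (by linarith [hfg s]) le_rfl
  have h3 := mul_le_mul_of_nonneg_left h2 (one_div_nonneg.2 hα₀.le)
  linarith

theorem cvar_const [IsProbabilityMeasure μ] (hα₀ : 0 < α) (hα₁ : α ≤ 1) (c : ℝ) :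
    cvar α μ (fun _ => c) = c := by
  refine le_antisymm ?_ (le_ciInf fun w => ?_)
  · simpa using cvar_le_objective (μ := μ) hα₀ hα₁ (integrable_const c) c
  · simpa using integral_le_cvar_objective (μ := μ) hα₀ hα₁ (integrable_const c) w

theorem cvar_mem_Icc [IsProbabilityMeasure μ] (hα₀ : 0 < α) (hα₁ : α ≤ 1)
    (hf : Integrable f μ) {lo hi : ℝ} (hb : ∀ s, f s ∈ Set.Icc lo hi) :
    cvar α μ f ∈ Set.Icc lo hi := by
  constructor
  · have := cvar_le_cvar_add hα₀ hα₁ (integrable_const lo) hf 0 fun s => by simpa using (hb s).1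
    rwa [cvar_const hα₀ hα₁, add_zero] at this
  · have := cvar_le_cvar_add hα₀ hα₁ hf (integrable_const hi) 0 fun s => by simpa using (hb s).2
    rwa [cvar_const hα₀ hα₁, add_zero] at this

theorem continuous_cvar_objective [IsProbabilityMeasure μ] (hf : Integrable f μ) :
    Continuous fun w : ℝ => w + 1 / α * ∫ s, max (f s - w) 0 ∂μ := by
  have h : LipschitzWith 1 fun w : ℝ => ∫ s, max (f s - w) 0 ∂μ := by
    refine LipschitzWith.of_dist_le_mul fun w w' => ?_
    rw [Real.dist_eq, ← integral_sub (integrable_posPart_sub hf _) (integrable_posPart_sub hf _)]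
    refine (norm_integral_le_of_norm_le_const (μ := μ) (C := |w - w'|)
      (f := fun s => max (f s - w) 0 - max (f s - w') 0) (.of_forall fun s => ?_)).trans ?_
    · refine (abs_max_sub_max_le_abs _ _ _).trans_eq ?_
      rw [sub_sub_sub_cancel_left, abs_sub_comm]
    · simp [Real.dist_eq]
  exact continuous_id.add (continuous_const.mul h.continuous)

/-- The infimum of a family of functions depending continuously on a real parameter is
measurable. -/
theorem measurable_iInf_of_continuous {F : S → ℝ → ℝ} (hc : ∀ s, Continuous (F s))
    (hm : ∀ w, Measurable fun s => F s w) :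
    Measurable fun s => ⨅ w, F s w := by
  -- By continuity the infimum over a countable dense set is the same, and countable infima preserve
  -- measurability.
  obtain ⟨D, hD, hDd⟩ := TopologicalSpace.exists_countable_dense ℝ
  have := hD.to_subtype
  have h : (fun s => ⨅ w, F s w) = fun s => ⨅ w : D, F s w :=
    funext fun s => (hDd.ciInf' (hc s)).symm
  rw [h]
  exact Measurable.iInf fun w => hm w

/-- A quantile `v` of `f` at level `α` with the corresponding (randomized) tail indicator `D`. -/
theorem exists_tail_weight [IsProbabilityMeasure μ] (hα₀ : 0 < α) (hα₁ : α ≤ 1)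
    (hf : Measurable f) {lo hi : ℝ} (hb : ∀ s, f s ∈ Set.Icc lo hi) :
    ∃ v ∈ Set.Icc lo hi, ∃ D : S → ℝ, Measurable D ∧ (∀ s, D s ∈ Set.Icc (0 : ℝ) 1) ∧
      ∫ s, D s ∂μ = α ∧ ∀ s, D s * (f s - v) = max (f s - v) 0 := by
  have hν : IsProbabilityMeasure (μ.map f) := Measure.isProbabilityMeasure_map hf.aemeasurable
  set ν := μ.map f
  have hne : Nonempty S := by
    by_contra hS
    rw [not_nonempty_iff] at hS
    have := measure_univ (μ := μ)
    simp [Set.univ_eq_empty_iff.2 hS] at this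
  have hlohi : lo ≤ hi := (hb hne.some).1.trans (hb hne.some).2
  -- The condition `lo ≤ v` keeps the quantile in range for `α = 1`, where the condition on the cdf
  -- holds for every `v`.
  set Q : Set ℝ := {v | lo ≤ v ∧ 1 - α ≤ cdf ν v}
  have hiQ : hi ∈ Q := by
    refine ⟨hlohi, ?_⟩
    have : cdf ν hi = 1 := by
      rw [cdf_eq_real, map_measureReal_apply hf measurableSet_Iic]
      have : f ⁻¹' Set.Iic hi = Set.univ := Set.eq_univ_of_forall fun s => (hb s).2
      rw [this, probReal_univ]
    rw [this]; linarith
  have hQb : BddBelow Q := ⟨lo, fun v hv => hv.1⟩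
  set v := sInf Q
  have hvlo : lo ≤ v := le_csInf ⟨hi, hiQ⟩ fun v hv => hv.1
  have hvhi : v ≤ hi := csInf_le hQb hiQ
  -- Right continuity of the cdf: the infimum defining `v` is attained.
  have h1 : 1 - α ≤ cdf ν v := by
    have hr := ((cdf ν).right_continuous v).mono_left
      (nhdsWithin_mono v Set.Ioi_subset_Ici_self)
    refine ge_of_tendsto hr ?_
    filter_upwards [self_mem_nhdsWithin] with w hw
    obtain ⟨q, hq, hqw⟩ := exists_lt_of_csInf_lt ⟨hi, hiQ⟩ hw
    exact hq.2.trans (monotone_cdf ν hqw.le)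
  have h2 : ∀ w < v, cdf ν w ≤ 1 - α := by
    intro w hw
    by_cases hwlo : lo ≤ w
    · by_contra hcon
      exact absurd (csInf_le hQb (show w ∈ Q from ⟨hwlo, (not_le.1 hcon).le⟩)) (not_le.2 hw)
    · have : cdf ν w = 0 := by
        rw [cdf_eq_real, map_measureReal_apply hf measurableSet_Iic]
        have : f ⁻¹' Set.Iic w = ∅ := Set.eq_empty_of_forall_notMem fun s hs =>
          hwlo ((hb s).1.trans hs)
        rw [this, measureReal_empty]
      rw [this]; linarith
  have h3 : μ.real {s | f s < v} ≤ 1 - α := by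
    have e : μ.real {s | f s < v} = ν.real (Set.Iio v) := by
      rw [map_measureReal_apply hf measurableSet_Iio]; rfl
    rw [e, ← measure_cdf ν, measureReal_def,
      (cdf ν).measure_Iio (tendsto_cdf_atBot ν), sub_zero]
    refine ENNReal.toReal_le_of_le_ofReal (by linarith) (ENNReal.ofReal_le_ofReal ?_)
    refine le_of_tendsto ((monotone_cdf ν).tendsto_leftLim v) ?_
    filter_upwards [self_mem_nhdsWithin] with w hw using h2 w hw
  have mG : MeasurableSet {s | v < f s} := measurableSet_lt measurable_const hf
  have mE : MeasurableSet {s | f s = v} := measurableSet_eq_fun hf measurable_const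
  have mL : MeasurableSet {s | f s < v} := measurableSet_lt hf measurable_const
  have h4 : μ.real {s | v < f s} ≤ α := by
    have e : μ.real {s | v < f s} = 1 - cdf ν v := by
      rw [cdf_eq_real, map_measureReal_apply hf measurableSet_Iic,
        ← probReal_compl_eq_one_sub (hf measurableSet_Iic)]
      congr 1; ext s; simp
    rw [e]; linarith
  have h5 : α ≤ μ.real {s | v < f s} + μ.real {s | f s = v} := by
    have hd : Disjoint {s | v < f s} {s | f s = v} :=
      Set.disjoint_left.2 fun s hs hs' => (ne_of_gt hs) hs'
    rw [← measureReal_union hd mE]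
    have e : {s | v < f s} ∪ {s | f s = v} = {s | f s < v}ᶜ := by
      ext s; simp [le_iff_lt_or_eq, eq_comm]
    rw [e, probReal_compl_eq_one_sub mL]; linarith
  -- `θ` is the share of the atom at `v` that completes the tail mass to exactly `α`. If the atom is
  -- null, the strict tail already has mass `α`.
  obtain ⟨θ, hθ₀, hθ₁, hθ⟩ : ∃ θ : ℝ, 0 ≤ θ ∧ θ ≤ 1 ∧
      θ * μ.real {s | f s = v} = α - μ.real {s | v < f s} := by
    rcases (measureReal_nonneg (μ := μ) (s := {s | f s = v})).eq_or_lt with h0 | h0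
    · exact ⟨0, le_rfl, zero_le_one, by linarith⟩
    · exact ⟨(α - μ.real {s | v < f s}) / μ.real {s | f s = v},
        div_nonneg (by linarith) h0.le, (div_le_one h0).2 (by linarith), div_mul_cancel₀ _ h0.ne'⟩
  refine ⟨v, ⟨hvlo, hvhi⟩, fun s => {s | v < f s}.indicator (fun _ => (1 : ℝ)) s +
    {s | f s = v}.indicator (fun _ => θ) s, ?_, fun s => ?_, ?_, fun s => ?_⟩
  · exact (measurable_const.indicator mG).add (measurable_const.indicator mE)
  · rcases lt_trichotomy v (f s) with h | h | h
    · simp [h, h.ne']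
    · simp [← h, hθ₀, hθ₁]
    · simp [h.not_gt, h.ne]
  · rw [integral_add ((integrable_const _).indicator mG) ((integrable_const _).indicator mE),
      integral_indicator_const _ mG, integral_indicator_const _ mE]
    simp only [smul_eq_mul, mul_one]
    linarith
  · rcases lt_trichotomy v (f s) with h | h | h
    · simp [h, h.ne', h.le]
    · simp [← h]
    · simp [h.not_gt, h.ne, h.le]

end CVaR

/-! ### The empirical estimator -/

section Empirical

variable {n : ℕ} {α : ℝ}

/-- The empirical estimator is the `CVaR` of the uniform distribution on the sample. -/
theorem empCVaR_eq_cvar (y : Fin n → ℝ) :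
    empCVaR α y = cvar α ((n : ℝ≥0∞)⁻¹ • Measure.count) y := by
  simp only [empCVaR, cvar]
  congr 1
  ext r
  rw [integral_smul_measure, integral_count]
  simp only [ENNReal.toReal_inv, ENNReal.toReal_natCast, smul_eq_mul]
  congr 1
  rw [one_div, mul_inv]
  ring

theorem isProbabilityMeasure_uniform (hn : n ≠ 0) :
    IsProbabilityMeasure ((n : ℝ≥0∞)⁻¹ • (Measure.count : Measure (Fin n))) := by
  constructor
  simp [Measure.count_univ, ENNReal.inv_mul_cancel, hn]

theorem integrable_uniform (hn : n ≠ 0) (y : Fin n → ℝ) :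
    Integrable y ((n : ℝ≥0∞)⁻¹ • (Measure.count : Measure (Fin n))) := by
  have := isProbabilityMeasure_uniform hn
  exact Integrable.of_finite

theorem empCVaR_le_empCVaR_add (hn : n ≠ 0) (hα₀ : 0 < α) (hα₁ : α ≤ 1) {y z : Fin n → ℝ} (c : ℝ)
    (hyz : ∀ i, y i ≤ z i + c) : empCVaR α y ≤ empCVaR α z + c := by
  have := isProbabilityMeasure_uniform hn
  rw [empCVaR_eq_cvar, empCVaR_eq_cvar]
  exact cvar_le_cvar_add hα₀ hα₁ (integrable_uniform hn y) (integrable_uniform hn z) c hyz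

theorem empCVaR_mem_Icc (hn : n ≠ 0) (hα₀ : 0 < α) (hα₁ : α ≤ 1) {y : Fin n → ℝ} {lo hi : ℝ}
    (hy : ∀ i, y i ∈ Set.Icc lo hi) : empCVaR α y ∈ Set.Icc lo hi := by
  have := isProbabilityMeasure_uniform hn
  rw [empCVaR_eq_cvar]
  exact cvar_mem_Icc hα₀ hα₁ (integrable_uniform hn y) hy

theorem measurable_empCVaR : Measurable (empCVaR α : (Fin n → ℝ) → ℝ) :=
  measurable_iInf_of_continuous (fun y => by fun_prop) fun w => by fun_prop

end Empirical


/-! ### Concentration of the empirical estimator -/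

section Concentration

variable {S : Type*} [MeasurableSpace S] {μ : Measure S} [IsProbabilityMeasure μ] {α : ℝ} {n : ℕ}

/-- A Chernoff bound for variables in `[0, 1]` with mean at most `α`. The sign `σ` selects the
upper or the lower tail. -/
theorem measure_sum_sub_integral_ge_le {U : S → ℝ} (hU : Measurable U)
    (hU01 : ∀ s, U s ∈ Set.Icc (0 : ℝ) 1) (hmean : ∫ s, U s ∂μ ≤ α) {ε : ℝ} (hε₀ : 0 ≤ ε)
    (hε₁ : ε ≤ 1) {σ : ℝ} (hσ : σ = 1 ∨ σ = -1) :
    (Measure.pi fun _ : Fin n => μ).real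
      {w | n * α * ε ≤ ∑ i, σ * (U (w i) - ∫ s, U s ∂μ)} ≤ Real.exp (-(n * α * ε ^ 2 / 4)) := by
  set m := ∫ s, U s ∂μ with hm
  have hUi : Integrable U μ := Integrable.of_mem_Icc 0 1 hU.aemeasurable (.of_forall hU01)
  have hσ2 : σ ^ 2 = 1 := by rcases hσ with rfl | rfl <;> norm_num
  have hσa : |σ| = 1 := by rcases hσ with rfl | rfl <;> norm_num
  -- This minimizes the exponent `-t * n * α * ε + n * t ^ 2 * α`. Since `ε ≤ 1`, the argument of
  -- the exponential stays in `[-1, 1]`, where `exp x ≤ 1 + x + x ^ 2`.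
  set t := ε / 2 with ht
  have hmeas : Measurable fun s => σ * (U s - m) := (hU.sub_const m).const_mul σ
  have hbd : ∀ s, σ * (U s - m) ∈ Set.Icc (-(1 + |m|)) (1 + |m|) := by
    intro s
    rw [Set.mem_Icc, ← abs_le, abs_mul, hσa, one_mul]
    refine (abs_sub _ _).trans ?_
    gcongr
    exact abs_le.2 ⟨by linarith [(hU01 s).1], (hU01 s).2⟩
  have hone : mgf (fun s => σ * (U s - m)) μ t ≤ Real.exp (t ^ 2 * α) := by
    have h1 : ∀ s, Real.exp (t * (σ * (U s - m))) ≤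
        Real.exp (-(t * σ * m)) * (1 + t * σ * U s + t ^ 2 * U s) := by
      intro s
      have e : t * (σ * (U s - m)) = -(t * σ * m) + t * σ * U s := by ring
      rw [e, Real.exp_add]
      refine mul_le_mul_of_nonneg_left ?_ (Real.exp_nonneg _)
      have hle : |t * σ * U s| ≤ 1 := by
        rw [abs_mul, abs_mul, hσa, abs_of_nonneg (hU01 s).1, abs_of_nonneg (by positivity)]
        nlinarith [(hU01 s).1, (hU01 s).2]
      have h2 := (abs_le.1 (Real.abs_exp_sub_one_sub_id_le hle)).2
      -- `U ^ 2 ≤ U` on `[0, 1]`: the second moment is controlled by the mean, hence by `α`.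
      have h3 : (t * σ * U s) ^ 2 ≤ t ^ 2 * U s := by
        have : (t * σ * U s) ^ 2 = t ^ 2 * (U s) ^ 2 := by rw [mul_pow, mul_pow, hσ2, mul_one]
        rw [this]
        refine mul_le_mul_of_nonneg_left ?_ (sq_nonneg t)
        nlinarith [(hU01 s).1, (hU01 s).2]
      linarith
    have i1 : Integrable (fun s => 1 + t * σ * U s) μ := (integrable_const _).add (hUi.const_mul _)
    have i2 : Integrable (fun s => 1 + t * σ * U s + t ^ 2 * U s) μ := i1.add (hUi.const_mul _)
    calc mgf (fun s => σ * (U s - m)) μ t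
        ≤ ∫ s, Real.exp (-(t * σ * m)) * (1 + t * σ * U s + t ^ 2 * U s) ∂μ :=
          integral_mono (integrable_exp_mul_of_mem_Icc hmeas.aemeasurable (.of_forall hbd))
            (i2.const_mul _) h1
      _ = Real.exp (-(t * σ * m)) * (1 + t * σ * m + t ^ 2 * m) := by
          rw [integral_const_mul, integral_add i1 (hUi.const_mul _),
            integral_add (integrable_const _) (hUi.const_mul _), integral_const_mul,
            integral_const_mul]
          simp [hm]
      _ ≤ Real.exp (-(t * σ * m)) * Real.exp (t * σ * m + t ^ 2 * α) := by
          refine mul_le_mul_of_nonneg_left ?_ (Real.exp_nonneg _)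
          have := Real.add_one_le_exp (t * σ * m + t ^ 2 * α)
          have := mul_le_mul_of_nonneg_left hmean (sq_nonneg t)
          linarith
      _ = Real.exp (t ^ 2 * α) := by rw [← Real.exp_add]; congr 1; ring
  have hind : iIndepFun (fun (i : Fin n) (w : Fin n → S) => σ * (U (w i) - m))
      (Measure.pi fun _ : Fin n => μ) :=
    iIndepFun_pi (X := fun _ s => σ * (U s - m)) fun _ => hmeas.aemeasurable
  have hmeas' : ∀ i : Fin n, Measurable fun w : Fin n → S => σ * (U (w i) - m) := fun i =>
    hmeas.comp (measurable_pi_apply i)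
  have hmgf : ∀ i : Fin n, mgf (fun w : Fin n → S => σ * (U (w i) - m))
      (Measure.pi fun _ : Fin n => μ) t = mgf (fun s => σ * (U s - m)) μ t := by
    intro i
    exact integral_comp_eval (μ := fun _ : Fin n => μ) (i := i)
      (f := fun s => Real.exp (t * (σ * (U s - m)))) (hmeas.const_mul t).exp.aestronglyMeasurable
  have hint : Integrable (fun w => Real.exp (t * (∑ i, fun w : Fin n → S => σ * (U (w i) - m)) w))
      (Measure.pi fun _ : Fin n => μ) :=
    hind.integrable_exp_mul_sum hmeas' fun i _ =>
      integrable_exp_mul_of_mem_Icc (hmeas' i).aemeasurable (.of_forall fun w => hbd (w i))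
  have hch := measure_ge_le_exp_mul_mgf (μ := Measure.pi fun _ : Fin n => μ)
    (X := ∑ i, fun w : Fin n → S => σ * (U (w i) - m)) (n * α * ε) (by positivity) hint
  rw [hind.mgf_sum hmeas'] at hch
  simp only [Finset.sum_apply] at hch
  refine hch.trans ?_
  calc Real.exp (-t * (n * α * ε)) * ∏ i : Fin n, mgf (fun w : Fin n → S => σ * (U (w i) - m))
        (Measure.pi fun _ : Fin n => μ) t
      ≤ Real.exp (-t * (n * α * ε)) * ∏ i : Fin n, Real.exp (t ^ 2 * α) := by
        refine mul_le_mul_of_nonneg_left ?_ (Real.exp_nonneg _)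
        exact Finset.prod_le_prod (fun _ _ => mgf_nonneg) fun i _ => (hmgf i).trans_le hone
    _ = Real.exp (-(n * α * ε ^ 2 / 4)) := by
        rw [Finset.prod_const, Finset.card_univ, Fintype.card_fin, ← Real.exp_nat_mul,
          ← Real.exp_add]
        congr 1
        rw [ht]; ring

/-- The empirical estimator exceeds `CVaR` by a large amount only with small probability. -/
theorem measure_empCVaR_sub_cvar_gt_le (hn : n ≠ 0) (hα₀ : 0 < α) (hα₁ : α ≤ 1) {f : S → ℝ}
    (hf : Measurable f) {lo hi : ℝ} (hb : ∀ s, f s ∈ Set.Icc lo hi) {L : ℝ} (hL : 0 ≤ L) :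
    (Measure.pi fun _ : Fin n => μ).real
      {w | (hi - lo) / α * √(L / (2 * n)) < empCVaR α (fun i => f (w i)) - cvar α μ f} ≤
      Real.exp (-L) := by
  have hfi : Integrable f μ := Integrable.of_mem_Icc lo hi hf.aemeasurable (.of_forall hb)
  have hn' : (0 : ℝ) < n := by exact_mod_cast Nat.pos_of_ne_zero hn
  have hsq := Real.sqrt_nonneg (L / (2 * n))
  rcases le_or_gt hi lo with hR | hR
  · have : {w : Fin n → S | (hi - lo) / α * √(L / (2 * n)) <
        empCVaR α (fun i => f (w i)) - cvar α μ f} = ∅ := by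
      refine Set.eq_empty_of_forall_notMem fun w hw => ?_
      have h1 := cvar_mem_Icc hα₀ hα₁ hfi hb
      have h2 := empCVaR_mem_Icc hn hα₀ hα₁ fun i => hb (w i)
      have h3 : hi = lo := le_antisymm hR (h1.1.trans h1.2)
      subst h3
      rw [Set.mem_ofPred_eq, sub_self, zero_div, zero_mul] at hw
      linarith [h2.2, h1.1]
    rw [this, measureReal_empty]
    exact Real.exp_nonneg _
  obtain ⟨v, hv, D, hDm, hD01, hDα, hDv⟩ := exists_tail_weight (μ := μ) hα₀ hα₁ hf hb
  have hDi : Integrable D μ := Integrable.of_mem_Icc 0 1 hDm.aemeasurable (.of_forall hD01)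
  have hDf : Integrable (fun s => D s * (f s - v)) μ := by
    simp only [hDv]; exact integrable_posPart_sub hfi v
  set g : S → ℝ := fun s => max (f s - v) 0 with hg
  have hgm : Measurable g := (hf.sub_const v).max measurable_const
  have hgb : ∀ s, g s ∈ Set.Icc 0 (hi - lo) := fun s =>
    ⟨le_max_right _ _, max_le (by linarith [(hb s).2, hv.1]) (by linarith)⟩
  -- `D` certifies that `v` is optimal: `E[(f - w)⁺] ≥ E[D * (f - w)] = E[(f - v)⁺] - (w - v) * α`
  -- for every `w`.
  have hcvar : v + 1 / α * ∫ s, g s ∂μ ≤ cvar α μ f := by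
    refine le_ciInf fun w => ?_
    have h1 : ∫ s, (D s * (f s - v) - (w - v) * D s) ∂μ ≤ ∫ s, max (f s - w) 0 ∂μ := by
      refine integral_mono (hDf.sub (hDi.const_mul _)) (integrable_posPart_sub hfi w) fun s => ?_
      have : D s * (f s - v) - (w - v) * D s = D s * (f s - w) := by ring
      simp only [this]
      exact (mul_le_mul_of_nonneg_left (le_max_left _ 0) (hD01 s).1).trans
        (mul_le_of_le_one_left (le_max_right _ _) (hD01 s).2)
    rw [integral_sub hDf (hDi.const_mul _), integral_const_mul, hDα] at h1
    simp only [hDv] at h1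
    have h2 := mul_le_mul_of_nonneg_left h1 (one_div_nonneg.2 hα₀.le)
    have h3 : 1 / α * (∫ s, g s ∂μ - (w - v) * α) = 1 / α * ∫ s, g s ∂μ - (w - v) := by
      field_simp
    simp only [hg] at h3 ⊢
    linarith
  have hind : iIndepFun (fun (i : Fin n) (w : Fin n → S) => g (w i) - ∫ s, g s ∂μ)
      (Measure.pi fun _ : Fin n => μ) :=
    iIndepFun_pi (X := fun _ s => g s - ∫ s, g s ∂μ) fun _ => (hgm.sub_const _).aemeasurable
  have hsub : ∀ i ∈ (Finset.univ : Finset (Fin n)),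
      HasSubgaussianMGF (fun w : Fin n → S => g (w i) - ∫ s, g s ∂μ)
        ((‖(hi - lo) - 0‖₊ / 2) ^ 2) (Measure.pi fun _ : Fin n => μ) := by
    intro i _
    have h := hasSubgaussianMGF_of_mem_Icc (μ := Measure.pi fun _ : Fin n => μ)
      (X := fun w => g (w i)) (hgm.comp (measurable_pi_apply i)).aemeasurable
      (.of_forall fun w => hgb (w i))
    rwa [integral_comp_eval (μ := fun _ : Fin n => μ) (i := i) hgm.aestronglyMeasurable] at h
  -- With sub-Gaussian parameter `((hi - lo) / 2) ^ 2` per summand, this deviation makes the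
  -- Hoeffding exponent exactly `-L`.
  have hho := HasSubgaussianMGF.measure_sum_ge_le_of_iIndepFun hind hsub
    (ε := n * ((hi - lo) * √(L / (2 * n))))
    (mul_nonneg hn'.le (mul_nonneg (by linarith) hsq))
  refine (measureReal_mono ?_).trans (hho.trans_eq ?_)
  · intro w hw
    rw [Set.mem_ofPred_eq] at hw ⊢
    have h1 : empCVaR α (fun i => f (w i)) ≤ v + 1 / (n * α) * ∑ i, g (w i) := by
      have := isProbabilityMeasure_uniform hn
      have h := cvar_le_objective hα₀ hα₁ (integrable_uniform hn fun i => f (w i)) v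
      rw [← empCVaR_eq_cvar, integral_smul_measure, integral_count] at h
      refine h.trans_eq ?_
      simp only [ENNReal.toReal_inv, ENNReal.toReal_natCast, smul_eq_mul, hg]
      rw [one_div, one_div, mul_inv]
      ring
    have h2 : (hi - lo) / α * √(L / (2 * n)) <
        1 / (n * α) * ∑ i, g (w i) - 1 / α * ∫ s, g s ∂μ := by linarith
    rw [Finset.sum_sub_distrib, Finset.sum_const, Finset.card_univ, Fintype.card_fin, nsmul_eq_mul]
    have h3 := mul_lt_mul_of_pos_left h2 (mul_pos hn' hα₀)
    have e1 : n * α * ((hi - lo) / α * √(L / (2 * n))) = n * ((hi - lo) * √(L / (2 * n))) := by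
      field_simp
    have e2 : n * α * (1 / (n * α) * ∑ i, g (w i) - 1 / α * ∫ s, g s ∂μ) =
        ∑ i, g (w i) - n * ∫ s, g s ∂μ := by
      field_simp
    rw [e1, e2] at h3
    exact h3.le
  · congr 1
    have hR' : 0 < hi - lo := by linarith
    simp only [Finset.sum_const, Finset.card_univ, Fintype.card_fin, nsmul_eq_mul, sub_zero]
    push_cast
    rw [Real.norm_of_nonneg hR'.le, mul_pow, mul_pow, Real.sq_sqrt (by positivity)]
    field_simp

/-- A lower bound for the empirical estimator from arbitrary weights `dᵢ ∈ [0, 1]`. -/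
theorem min_le_empCVaR (hn : n ≠ 0) (hα₀ : 0 < α) (hα₁ : α ≤ 1) {y d : Fin n → ℝ} {lo hi : ℝ}
    (hy : ∀ i, y i ∈ Set.Icc lo hi) (hd : ∀ i, d i ∈ Set.Icc (0 : ℝ) 1) :
    min (lo + 1 / (n * α) * ∑ i, d i * (y i - lo)) (hi - 1 / (n * α) * ∑ i, d i * (hi - y i)) ≤
      empCVaR α y := by
  have hn' : (0 : ℝ) < n := by exact_mod_cast Nat.pos_of_ne_zero hn
  have hc : 0 < 1 / (n * α) := by positivity
  refine le_ciInf fun r => ?_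
  -- Outside `[lo, hi]` there is nothing to gain: the objective has slope `1 - 1 / α ≤ 0` below `lo`
  -- and equals `r` above `hi`.
  rcases lt_or_ge r lo with h1 | h1
  · refine (min_le_left _ _).trans ?_
    have h2 : ∑ i, (d i * (y i - lo) + (lo - r)) ≤ ∑ i, max (y i - r) 0 :=
      Finset.sum_le_sum fun i _ => by
        have := mul_le_of_le_one_left (sub_nonneg.2 (hy i).1) (hd i).2
        have := le_max_left (y i - r) 0
        linarith
    rw [Finset.sum_add_distrib, Finset.sum_const, Finset.card_univ, Fintype.card_fin,
      nsmul_eq_mul] at h2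
    have h3 := mul_le_mul_of_nonneg_left h2 hc.le
    have e : 1 / (n * α) * (∑ i, d i * (y i - lo) + n * (lo - r)) =
        1 / (n * α) * ∑ i, d i * (y i - lo) + (lo - r) / α := by field_simp
    have h4 : lo - r ≤ (lo - r) / α := by
      rw [le_div_iff₀ hα₀]; nlinarith
    linarith
  rcases lt_or_ge hi r with h2 | h2
  · refine (min_le_right _ _).trans ?_
    have h3 : 0 ≤ ∑ i, d i * (hi - y i) :=
      Finset.sum_nonneg fun i _ => mul_nonneg (hd i).1 (sub_nonneg.2 (hy i).2)
    have h4 : 0 ≤ ∑ i, max (y i - r) 0 := Finset.sum_nonneg fun i _ => le_max_right _ _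
    have := mul_nonneg hc.le h3
    have := mul_nonneg hc.le h4
    linarith
  have h3 : ∑ i, d i * (y i - r) ≤ ∑ i, max (y i - r) 0 := Finset.sum_le_sum fun i _ =>
    (mul_le_mul_of_nonneg_left (le_max_left _ 0) (hd i).1).trans
      (mul_le_of_le_one_left (le_max_right _ _) (hd i).2)
  have h4 := mul_le_mul_of_nonneg_left h3 hc.le
  have e1 : ∑ i, d i * (y i - r) = ∑ i, d i * (y i - lo) - (r - lo) * ∑ i, d i := by
    rw [Finset.mul_sum, ← Finset.sum_sub_distrib]
    exact Finset.sum_congr rfl fun i _ => by ring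
  have e2 : ∑ i, d i * (y i - r) = (hi - r) * ∑ i, d i - ∑ i, d i * (hi - y i) := by
    rw [Finset.mul_sum, ← Finset.sum_sub_distrib]
    exact Finset.sum_congr rfl fun i _ => by ring
  -- On `[lo, hi]` the dual lower bound is affine in `r` with slope `1 - (∑ d i) / (n * α)`. Its
  -- sign decides which endpoint is the minimum, so the random total weight need not equal `n * α`.
  rcases le_or_gt (1 / (n * α) * ∑ i, d i) 1 with h5 | h5
  · refine (min_le_left _ _).trans ?_
    have := mul_nonneg (sub_nonneg.2 h1) (sub_nonneg.2 h5)
    rw [e1] at h4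
    linarith
  · refine (min_le_right _ _).trans ?_
    have := mul_nonneg (sub_nonneg.2 h2) (sub_nonneg.2 h5.le)
    rw [e2] at h4
    linarith

/-- The empirical estimator falls below `CVaR` by a large amount only with small probability. -/
theorem measure_cvar_sub_empCVaR_gt_le (hn : n ≠ 0) (hα₀ : 0 < α) (hα₁ : α ≤ 1) {f : S → ℝ}
    (hf : Measurable f) {lo hi : ℝ} (hb : ∀ s, f s ∈ Set.Icc lo hi) {L : ℝ} (hL : 0 ≤ L) :
    (Measure.pi fun _ : Fin n => μ).real
      {w | (hi - lo) * √(5 * L / (α * n)) < cvar α μ f - empCVaR α (fun i => f (w i))} ≤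
      3 * Real.exp (-L) := by
  have hfi : Integrable f μ := Integrable.of_mem_Icc lo hi hf.aemeasurable (.of_forall hb)
  have hn' : (0 : ℝ) < n := by exact_mod_cast Nat.pos_of_ne_zero hn
  set ε := √(5 * L / (α * n)) with hε
  have hε₀ : 0 ≤ ε := Real.sqrt_nonneg _
  have hcv := cvar_mem_Icc hα₀ hα₁ hfi hb
  -- Both quantities lie in `[lo, hi]`, so only deviations below `hi - lo` matter. This forces `ε ≤
  -- 1`, as the Chernoff bound requires.
  by_cases htriv : hi - lo ≤ (hi - lo) * ε
  · have : {w : Fin n → S | (hi - lo) * ε < cvar α μ f - empCVaR α (fun i => f (w i))} = ∅ := by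
      refine Set.eq_empty_of_forall_notMem fun w hw => ?_
      have h2 := empCVaR_mem_Icc hn hα₀ hα₁ fun i => hb (w i)
      rw [Set.mem_ofPred_eq] at hw
      linarith [h2.1, hcv.2]
    rw [this, measureReal_empty]
    positivity
  have hR : 0 < hi - lo := by
    refine (sub_nonneg.2 (hcv.1.trans hcv.2)).lt_of_ne fun h => htriv ?_
    rw [← h, zero_mul]
  have hε₁ : ε ≤ 1 := by
    by_contra hcon
    exact htriv (le_mul_of_one_le_right hR.le (not_le.1 hcon).le)
  obtain ⟨v, hv, D, hDm, hD01, hDα, hDv⟩ := exists_tail_weight (μ := μ) hα₀ hα₁ hf hb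
  have hDi : Integrable D μ := Integrable.of_mem_Icc 0 1 hDm.aemeasurable (.of_forall hD01)
  have hDf : Integrable (fun s => D s * (f s - v)) μ := by
    simp only [hDv]; exact integrable_posPart_sub hfi v
  -- The two dual bounds with `d = D`, rescaled. Both `U` and `W` lie below `D`, hence have mean at
  -- most `α`.
  set U : S → ℝ := fun s => D s * (f s - lo) / (hi - lo) with hUdef
  set W : S → ℝ := fun s => D s * (hi - f s) / (hi - lo) with hWdef
  have hUm : Measurable U := (hDm.mul (hf.sub_const lo)).div_const _
  have hWm : Measurable W := (hDm.mul (measurable_const.sub hf)).div_const _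
  have hU0 : ∀ s, 0 ≤ U s := fun s =>
    div_nonneg (mul_nonneg (hD01 s).1 (sub_nonneg.2 (hb s).1)) hR.le
  have hW0 : ∀ s, 0 ≤ W s := fun s =>
    div_nonneg (mul_nonneg (hD01 s).1 (sub_nonneg.2 (hb s).2)) hR.le
  have hUD : ∀ s, U s ≤ D s := fun s => by
    rw [hUdef, div_le_iff₀ hR]
    exact mul_le_mul_of_nonneg_left (by linarith [(hb s).2]) (hD01 s).1
  have hWD : ∀ s, W s ≤ D s := fun s => by
    rw [hWdef, div_le_iff₀ hR]
    exact mul_le_mul_of_nonneg_left (by linarith [(hb s).1]) (hD01 s).1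
  have hU01 : ∀ s, U s ∈ Set.Icc (0 : ℝ) 1 := fun s => ⟨hU0 s, (hUD s).trans (hD01 s).2⟩
  have hW01 : ∀ s, W s ∈ Set.Icc (0 : ℝ) 1 := fun s => ⟨hW0 s, (hWD s).trans (hD01 s).2⟩
  have hUi : Integrable U μ := Integrable.of_mem_Icc 0 1 hUm.aemeasurable (.of_forall hU01)
  have hWi : Integrable W μ := Integrable.of_mem_Icc 0 1 hWm.aemeasurable (.of_forall hW01)
  have hUα : ∫ s, U s ∂μ ≤ α := (integral_mono hUi hDi hUD).trans_eq hDα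
  have hWα : ∫ s, W s ∂μ ≤ α := (integral_mono hWi hDi hWD).trans_eq hDα
  have hobj := cvar_le_objective hα₀ hα₁ hfi v
  -- Because `∫ D = α` exactly, the base point `v` of the objective can be moved to `lo`, and in
  -- `hcW` to `hi`, without changing its value.
  have hcU : cvar α μ f ≤ lo + 1 / α * ((hi - lo) * ∫ s, U s ∂μ) := by
    have e : ∫ s, max (f s - v) 0 ∂μ = (hi - lo) * ∫ s, U s ∂μ - (v - lo) * α := by
      rw [← hDα, ← integral_const_mul, ← integral_const_mul,
        ← integral_sub (hUi.const_mul _) (hDi.const_mul _)]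
      refine integral_congr_ae (.of_forall fun s => ?_)
      simp only [← hDv, hUdef]
      field_simp
      ring
    rw [e] at hobj
    refine hobj.trans_eq ?_
    field_simp
    ring
  have hcW : cvar α μ f ≤ hi - 1 / α * ((hi - lo) * ∫ s, W s ∂μ) := by
    have e : ∫ s, max (f s - v) 0 ∂μ = (hi - v) * α - (hi - lo) * ∫ s, W s ∂μ := by
      rw [← hDα, ← integral_const_mul, ← integral_const_mul,
        ← integral_sub (hDi.const_mul _) (hWi.const_mul _)]
      refine integral_congr_ae (.of_forall fun s => ?_)
      simp only [← hDv, hWdef]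
      field_simp
      ring
    rw [e] at hobj
    refine hobj.trans_eq ?_
    field_simp
    ring
  have hsub : {w : Fin n → S | (hi - lo) * ε < cvar α μ f - empCVaR α (fun i => f (w i))} ⊆
      {w | n * α * ε ≤ ∑ i, (-1 : ℝ) * (U (w i) - ∫ s, U s ∂μ)} ∪
      {w | n * α * ε ≤ ∑ i, (1 : ℝ) * (W (w i) - ∫ s, W s ∂μ)} := by
    intro w hw
    rw [Set.mem_ofPred_eq] at hw
    have hcα : 0 < n * α / (hi - lo) := by positivity
    rcases min_le_iff.1 (min_le_empCVaR hn hα₀ hα₁ (fun i => hb (w i)) fun i => hD01 (w i))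
      with h | h
    · left
      have h1 : (hi - lo) * ε < 1 / α * ((hi - lo) * ∫ s, U s ∂μ) -
          1 / (n * α) * ∑ i, D (w i) * (f (w i) - lo) := by linarith
      have h2 := mul_lt_mul_of_pos_left h1 hcα
      have e : ∑ i, D (w i) * (f (w i) - lo) = (hi - lo) * ∑ i, U (w i) := by
        rw [Finset.mul_sum]
        exact Finset.sum_congr rfl fun i _ => by simp only [hUdef]; field_simp
      rw [e] at h2
      rw [Set.mem_ofPred_eq, ← Finset.mul_sum, Finset.sum_sub_distrib, Finset.sum_const,
        Finset.card_univ, Fintype.card_fin, nsmul_eq_mul]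
      refine le_of_eq_of_le ?_ (h2.le.trans_eq ?_)
      · field_simp
      · field_simp
        ring
    · right
      have h1 : (hi - lo) * ε < 1 / (n * α) * ∑ i, D (w i) * (hi - f (w i)) -
          1 / α * ((hi - lo) * ∫ s, W s ∂μ) := by linarith
      have h2 := mul_lt_mul_of_pos_left h1 hcα
      have e : ∑ i, D (w i) * (hi - f (w i)) = (hi - lo) * ∑ i, W (w i) := by
        rw [Finset.mul_sum]
        exact Finset.sum_congr rfl fun i _ => by simp only [hWdef]; field_simp
      rw [e] at h2
      rw [Set.mem_ofPred_eq, ← Finset.mul_sum, Finset.sum_sub_distrib, Finset.sum_const,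
        Finset.card_univ, Fintype.card_fin, nsmul_eq_mul]
      refine le_of_eq_of_le ?_ (h2.le.trans_eq ?_)
      · field_simp
      · field_simp
  have hchU := measure_sum_sub_integral_ge_le (n := n) hUm hU01 hUα hε₀ hε₁ (Or.inr rfl)
  have hchW := measure_sum_sub_integral_ge_le (n := n) hWm hW01 hWα hε₀ hε₁ (Or.inl rfl)
  -- The constant `5` makes the exponent `5 / 4 * L`, and there are only two events, so the factor
  -- `3` also has slack.
  have hexp : Real.exp (-(n * α * ε ^ 2 / 4)) ≤ Real.exp (-L) := by
    rw [Real.exp_le_exp, hε, Real.sq_sqrt (by positivity)]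
    have : n * α * (5 * L / (α * n)) / 4 = 5 / 4 * L := by field_simp
    rw [this]; linarith
  have h1 := (measureReal_mono (μ := Measure.pi fun _ : Fin n => μ) hsub).trans
    (measureReal_union_le _ _)
  have := Real.exp_nonneg (-L)
  linarith

end Concentration


/-! ### Measurability, bounds and error propagation for sparse sampling -/

theorem measurable_finset_univ_inf' {S A : Type*} [MeasurableSpace S] [Fintype A] [Nonempty A]
    {F : A → S → ℝ} (hF : ∀ a, Measurable (F a)) :
    Measurable fun s => Finset.univ.inf' Finset.univ_nonempty fun a => F a s := by
  have h : Measurable (Finset.univ.inf' Finset.univ_nonempty F) :=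
    Finset.inf'_induction _ _ (fun _ h _ h' => h.inf h') fun a _ => hF a
  convert h using 1
  ext s
  rw [Finset.inf'_apply]

/-- The image of a Markov kernel under a map depending on the parameter is measurable. -/
theorem measurable_map_param {S E F : Type*} [MeasurableSpace S] [MeasurableSpace E]
    [MeasurableSpace F] {κ : S → Measure E} (hκ : Measurable κ)
    (hp : ∀ s, IsProbabilityMeasure (κ s)) {f : S → E → F}
    (hf : Measurable fun p : S × E => f p.1 p.2) : Measurable fun s => (κ s).map (f s) := by
  let η : Kernel S E := ⟨κ, hκ⟩
  have : IsMarkovKernel η := ⟨hp⟩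
  refine Measure.measurable_of_measurable_coe _ fun t ht => ?_
  have h : ∀ s, (κ s).map (f s) t = η s (Prod.mk s ⁻¹' ((fun p : S × E => f p.1 p.2) ⁻¹' t)) :=
    fun s => Measure.map_apply (hf.comp measurable_prodMk_left) ht
  simp only [h]
  exact Kernel.measurable_kernel_prodMk_left (hf ht)

/-- A bound on all sections of a set bounds its measure with respect to the composition-product. -/
theorem measureReal_compProd_le {S E : Type*} [MeasurableSpace S] [MeasurableSpace E]
    {μ : Measure S} [IsProbabilityMeasure μ] {κ : Kernel S E} [IsMarkovKernel κ]
    {t : Set (S × E)} (ht : MeasurableSet t) {p : ℝ} (hp₀ : 0 ≤ p)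
    (hp : ∀ s, (κ s).real (Prod.mk s ⁻¹' t) ≤ p) : (μ ⊗ₘ κ).real t ≤ p := by
  refine ENNReal.toReal_le_of_le_ofReal hp₀ ?_
  rw [Measure.compProd_apply ht]
  calc ∫⁻ s, κ s (Prod.mk s ⁻¹' t) ∂μ ≤ ∫⁻ _, ENNReal.ofReal p ∂μ :=
        lintegral_mono fun s => by
          rw [← ofReal_measureReal]
          exact ENNReal.ofReal_le_ofReal (hp s)
    _ = ENNReal.ofReal p := by simp

namespace MDP

variable {S A : Type*} [MeasurableSpace S] [Fintype A] [Nonempty A]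

/-- An MDP with Markov transition kernels, measurable costs in `[Rmin, Rmax]`, and discount factor
in `[0, 1]`. -/
structure IsBounded (M : MDP S A) (Rmin Rmax : ℝ) : Prop where
  markov : ∀ a, IsMarkovKernel (M.τ a)
  measurable_cost : ∀ a, Measurable fun s => M.ρ s a
  cost_mem : ∀ s a, M.ρ s a ∈ Set.Icc Rmin Rmax
  le : Rmin ≤ Rmax
  γ_nonneg : 0 ≤ M.γ
  γ_le_one : M.γ ≤ 1

variable {M : MDP S A} {Rmin Rmax α : ℝ}

/-- Each stage lengthens the range by at most `Rmax - Rmin`, as `γ ≤ 1`. The left end is left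
unspecified because concentration depends only on the length. -/
theorem IsBounded.optValueToGo (hM : M.IsBounded Rmin Rmax) (hα₀ : 0 < α) (hα₁ : α ≤ 1) (n : ℕ) :
    Measurable (M.optValueToGo α n) ∧
      ∃ lo, ∀ s, M.optValueToGo α n s ∈ Set.Icc lo (lo + n * (Rmax - Rmin)) := by
  induction n with
  | zero => exact ⟨measurable_const, 0, fun s => by simp [MDP.optValueToGo]⟩
  | succ n ih =>
    obtain ⟨hm, lo, hlo⟩ := ih
    have hmk := hM.markov
    have hint : ∀ a s, Integrable (M.optValueToGo α n) (M.τ a s) := fun a s =>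
      Integrable.of_mem_Icc _ _ hm.aemeasurable (.of_forall hlo)
    refine ⟨measurable_finset_univ_inf' fun a => (hM.measurable_cost a).add
      (Measurable.const_mul (measurable_iInf_of_continuous
        (fun s => continuous_cvar_objective (hint a s)) fun w => ?_) _),
      Rmin + M.γ * lo, fun s => ?_⟩
    · have h : Measurable fun s => max (M.optValueToGo α n s - w) 0 :=
        (hm.sub_const w).max measurable_const
      exact (h.stronglyMeasurable.integral_kernel (κ := M.τ a)).measurable.const_mul _ |>.const_add _
    · have hq : ∀ a, M.ρ s a + M.γ * cvar α (M.τ a s) (M.optValueToGo α n) ∈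
          Set.Icc (Rmin + M.γ * lo) (Rmin + M.γ * lo + (n + 1 : ℕ) * (Rmax - Rmin)) := by
        intro a
        have hc := cvar_mem_Icc hα₀ hα₁ (hint a s) hlo
        have hr := hM.cost_mem s a
        have h1 := mul_le_mul_of_nonneg_left hc.1 hM.γ_nonneg
        have h2 := mul_le_mul_of_nonneg_left hc.2 hM.γ_nonneg
        have h3 : M.γ * (n * (Rmax - Rmin)) ≤ n * (Rmax - Rmin) :=
          mul_le_of_le_one_left (mul_nonneg n.cast_nonneg (sub_nonneg.2 hM.le)) hM.γ_le_one
        push_cast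
        constructor <;> nlinarith [hr.1, hr.2]
      obtain ⟨a⟩ := ‹Nonempty A›
      exact ⟨Finset.le_inf' _ _ fun a _ => (hq a).1,
        (Finset.inf'_le _ (Finset.mem_univ a)).trans (hq a).2⟩

/-- Measurability in the state is carried along with total mass one, since the `bind` of the next
stage needs a measurable family. -/
theorem IsBounded.sparseSamplingToGo (hM : M.IsBounded Rmin Rmax) (Nb n : ℕ) :
    Measurable (M.sparseSamplingToGo α Nb n) ∧
      ∀ s, IsProbabilityMeasure (M.sparseSamplingToGo α Nb n s) := by
  induction n with
  | zero => exact ⟨measurable_const, fun s => Measure.dirac.isProbabilityMeasure⟩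
  | succ n ih =>
    obtain ⟨hm, hp⟩ := ih
    have hmk := hM.markov
    have hb : ∀ a s, IsProbabilityMeasure ((M.τ a s).bind (M.sparseSamplingToGo α Nb n)) :=
      fun a s => isProbabilityMeasure_bind hm.aemeasurable (.of_forall hp)
    have hbm : ∀ a, Measurable fun s => (M.τ a s).bind (M.sparseSamplingToGo α Nb n) :=
      fun a => (Measure.measurable_bind' hm).comp (M.τ a).measurable
    have hf : ∀ a, Measurable fun p : S × (Fin Nb → ℝ) => M.ρ p.1 a + M.γ * empCVaR α p.2 :=
      fun a => ((hM.measurable_cost a).comp measurable_fst).add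
        ((measurable_empCVaR.comp measurable_snd).const_mul _)
    have hQ : ∀ a s, IsProbabilityMeasure
        ((Measure.pi fun _ : Fin Nb => (M.τ a s).bind (M.sparseSamplingToGo α Nb n)).map
          fun v => M.ρ s a + M.γ * empCVaR α v) := fun a s =>
      Measure.isProbabilityMeasure_map ((hf a).comp measurable_prodMk_left).aemeasurable
    have hQm : ∀ a, Measurable fun s =>
        ((Measure.pi fun _ : Fin Nb => (M.τ a s).bind (M.sparseSamplingToGo α Nb n)).map
          fun v => M.ρ s a + M.γ * empCVaR α v) := fun a =>
      measurable_map_param (POMDP.measurable_pi_measure (fun _ => hbm a) fun _ => hb a)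
        (fun s => inferInstance) (hf a)
    have hmin : Measurable fun q : A → ℝ => Finset.univ.inf' Finset.univ_nonempty q :=
      measurable_finset_univ_inf' fun a => measurable_pi_apply a
    exact ⟨(Measure.measurable_map _ hmin).comp (POMDP.measurable_pi_measure hQm hQ),
      fun s => Measure.isProbabilityMeasure_map hmin.aemeasurable⟩

/-- Error of the empirical estimator under a one-sided perturbation of the sample. -/
theorem sign_mul_empCVaR_sub_le {n : ℕ} (hn : n ≠ 0) (hα₀ : 0 < α) (hα₁ : α ≤ 1) {σ : ℝ}
    (hσ : σ = 1 ∨ σ = -1) {y z : Fin n → ℝ} {c : ℝ} (h : ∀ i, σ * (y i - z i) ≤ c) :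
    σ * (empCVaR α y - empCVaR α z) ≤ c := by
  rcases hσ with rfl | rfl
  · have := empCVaR_le_empCVaR_add hn hα₀ hα₁ (y := y) (z := z) c fun i => by linarith [h i]
    linarith
  · have := empCVaR_le_empCVaR_add hn hα₀ hα₁ (y := z) (z := y) c fun i => by linarith [h i]
    linarith

/-- Error of the minimum under a one-sided perturbation. -/
theorem exists_lt_sign_mul_sub_of_lt {σ : ℝ} (hσ : σ = 1 ∨ σ = -1) {q r : A → ℝ} {c : ℝ}
    (h : c < σ * (Finset.univ.inf' Finset.univ_nonempty q -
      Finset.univ.inf' Finset.univ_nonempty r)) : ∃ a, c < σ * (q a - r a) := by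
  rcases hσ with rfl | rfl
  · obtain ⟨a, -, ha⟩ := Finset.exists_mem_eq_inf' Finset.univ_nonempty r
    refine ⟨a, h.trans_le ?_⟩
    have := Finset.inf'_le q (Finset.mem_univ a)
    rw [ha]
    linarith
  · obtain ⟨a, -, ha⟩ := Finset.exists_mem_eq_inf' Finset.univ_nonempty q
    refine ⟨a, h.trans_le ?_⟩
    have := Finset.inf'_le r (Finset.mem_univ a)
    rw [ha]
    linarith

/-- Propagation of one-sided error bounds over one stage: `E` and `p` bound the error and the
failure probability of the recursive calls, `C` and `q` those of the `CVaR` estimator. -/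
theorem IsBounded.measure_error_succ_le (hM : M.IsBounded Rmin Rmax) (hα₀ : 0 < α) (hα₁ : α ≤ 1)
    {Nb : ℕ} (hNb : Nb ≠ 0) {σ : ℝ} (hσ : σ = 1 ∨ σ = -1) {n : ℕ} {E C p q : ℝ} (hp₀ : 0 ≤ p)
    (hprev : ∀ s, (M.sparseSamplingToGo α Nb n s).real
      {v | E < σ * (M.optValueToGo α n s - v)} ≤ p)
    (hconc : ∀ s a, (Measure.pi fun _ : Fin Nb => M.τ a s).real
      {w | C < σ * (cvar α (M.τ a s) (M.optValueToGo α n) -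
        empCVaR α fun i => M.optValueToGo α n (w i))} ≤ q) (s : S) :
    (M.sparseSamplingToGo α Nb (n + 1) s).real
      {v | M.γ * (E + C) < σ * (M.optValueToGo α (n + 1) s - v)} ≤
      Fintype.card A * (q + Nb * p) := by
  obtain ⟨hm, hp⟩ := hM.sparseSamplingToGo (α := α) Nb n
  obtain ⟨hVm, -⟩ := hM.optValueToGo hα₀ hα₁ n
  have hmk := hM.markov
  let κ : Kernel S ℝ := ⟨M.sparseSamplingToGo α Nb n, hm⟩
  have hκ : IsMarkovKernel κ := ⟨hp⟩
  set V := M.optValueToGo α n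
  -- The coupling: a returned value is the second coordinate of a pair whose first coordinate is the
  -- successor it estimates.
  have hb : ∀ a, (M.τ a s).bind (M.sparseSamplingToGo α Nb n) = (M.τ a s ⊗ₘ κ).map Prod.snd :=
    fun a => (Measure.snd_compProd (M.τ a s) κ).symm
  have hbp : ∀ a, IsProbabilityMeasure ((M.τ a s).bind (M.sparseSamplingToGo α Nb n)) :=
    fun a => isProbabilityMeasure_bind hm.aemeasurable (.of_forall hp)
  have hf : ∀ a, Measurable fun v : Fin Nb → ℝ => M.ρ s a + M.γ * empCVaR α v :=
    fun a => (measurable_empCVaR.const_mul _).const_add _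
  have hQ : ∀ a, IsProbabilityMeasure
      ((Measure.pi fun _ : Fin Nb => (M.τ a s).bind (M.sparseSamplingToGo α Nb n)).map
        fun v => M.ρ s a + M.γ * empCVaR α v) := fun a =>
    Measure.isProbabilityMeasure_map (hf a).aemeasurable
  have hmin : Measurable fun q : A → ℝ => Finset.univ.inf' Finset.univ_nonempty q :=
    measurable_finset_univ_inf' fun a => measurable_pi_apply a
  have hset : ∀ c x : ℝ, MeasurableSet {v : ℝ | c < σ * (x - v)} := fun c x =>
    measurableSet_lt measurable_const ((measurable_const.sub measurable_id).const_mul σ)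
  have haction : ∀ a, ((Measure.pi fun _ : Fin Nb =>
      (M.τ a s).bind (M.sparseSamplingToGo α Nb n)).map
        fun v => M.ρ s a + M.γ * empCVaR α v).real
        {x | M.γ * (E + C) < σ * (M.ρ s a + M.γ * cvar α (M.τ a s) V - x)} ≤ q + Nb * p := by
    intro a
    have hbp' : IsProbabilityMeasure ((M.τ a s ⊗ₘ κ).map Prod.snd) := by
      rw [← hb a]; exact hbp a
    have hpi : (Measure.pi fun _ : Fin Nb => (M.τ a s).bind (M.sparseSamplingToGo α Nb n)) =
        (Measure.pi fun _ : Fin Nb => M.τ a s ⊗ₘ κ).map fun w i => (w i).2 := by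
      rw [hb a]
      exact (Measure.pi_map_pi fun _ => measurable_snd.aemeasurable).symm
    have hfst : (Measure.pi fun _ : Fin Nb => M.τ a s) =
        (Measure.pi fun _ : Fin Nb => M.τ a s ⊗ₘ κ).map fun w i => (w i).1 := by
      have e : (M.τ a s ⊗ₘ κ).map Prod.fst = M.τ a s := Measure.fst_compProd (M.τ a s) κ
      have : IsProbabilityMeasure ((M.τ a s ⊗ₘ κ).map Prod.fst) := by rw [e]; infer_instance
      refine Eq.trans ?_ (Measure.pi_map_pi fun _ => measurable_fst.aemeasurable).symm
      rw [e]
    have hsnd_m : Measurable fun (w : Fin Nb → S × ℝ) i => (w i).2 :=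
      measurable_pi_lambda _ fun i => measurable_snd.comp (measurable_pi_apply i)
    have hfst_m : Measurable fun (w : Fin Nb → S × ℝ) i => (w i).1 :=
      measurable_pi_lambda _ fun i => measurable_fst.comp (measurable_pi_apply i)
    rw [map_measureReal_apply (hf a) (hset _ _), hpi,
      map_measureReal_apply hsnd_m ((hf a) (hset _ _))]
    -- Off the union, the estimator on the exact values is within `C` and each recursive call within
    -- `E`, so one-sided stability of `empCVaR` adds the two.
    have hsub : (fun (w : Fin Nb → S × ℝ) i => (w i).2) ⁻¹'
        ((fun v => M.ρ s a + M.γ * empCVaR α v) ⁻¹' {x | M.γ * (E + C) < σ * (M.ρ s a + M.γ * cvar α (M.τ a s) V - x)}) ⊆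
        ((fun (w : Fin Nb → S × ℝ) i => (w i).1) ⁻¹'
          {w | C < σ * (cvar α (M.τ a s) V - empCVaR α fun i => V (w i))}) ∪
        ⋃ i, (Function.eval i ⁻¹' {x : S × ℝ | E < σ * (V x.1 - x.2)}) := by
      intro w hw
      by_contra hcon
      simp only [Set.mem_union, Set.mem_iUnion, Set.mem_preimage, Set.mem_ofPred_eq, not_or,
        not_exists, not_lt, Function.eval] at hcon hw
      have h1 := sign_mul_empCVaR_sub_le hNb hα₀ hα₁ hσ hcon.2
      have h2 : M.γ * (E + C) < M.γ *
          (σ * (cvar α (M.τ a s) V - empCVaR α fun i => (w i).2)) := by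
        refine hw.trans_eq ?_
        ring
      have h3 := lt_of_mul_lt_mul_left h2 hM.γ_nonneg
      linarith [hcon.1]
    have hmE : MeasurableSet {x : S × ℝ | E < σ * (V x.1 - x.2)} :=
      measurableSet_lt measurable_const
        (((hVm.comp measurable_fst).sub measurable_snd).const_mul σ)
    have hmC : MeasurableSet {w : Fin Nb → S |
        C < σ * (cvar α (M.τ a s) V - empCVaR α fun i => V (w i))} :=
      measurableSet_lt measurable_const ((measurable_const.sub (measurable_empCVaR.comp
        (measurable_pi_lambda _ fun i => hVm.comp (measurable_pi_apply i)))).const_mul σ)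
    refine (measureReal_mono hsub).trans ((measureReal_union_le _ _).trans (add_le_add ?_ ?_))
    · rw [← map_measureReal_apply hfst_m hmC, ← hfst]
      exact hconc s a
    · refine (measureReal_iUnion_fintype_le _).trans ?_
      calc ∑ i, (Measure.pi fun _ : Fin Nb => M.τ a s ⊗ₘ κ).real
            (Function.eval i ⁻¹' {x : S × ℝ | E < σ * (V x.1 - x.2)})
          ≤ ∑ _i : Fin Nb, p := Finset.sum_le_sum fun i _ => by
            rw [← map_measureReal_apply (measurable_pi_apply i) hmE,
              (measurePreserving_eval (fun _ : Fin Nb => M.τ a s ⊗ₘ κ) i).map_eq]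
            exact measureReal_compProd_le hmE hp₀ fun s' => hprev s'
        _ = Nb * p := by simp
  change ((Measure.pi fun a : A =>
        (Measure.pi fun _ : Fin Nb => (M.τ a s).bind (M.sparseSamplingToGo α Nb n)).map
          fun v => M.ρ s a + M.γ * empCVaR α v).map
      fun q => Finset.univ.inf' Finset.univ_nonempty q).real _ ≤ _
  rw [map_measureReal_apply hmin (hset _ _)]
  have hsub : (fun q : A → ℝ => Finset.univ.inf' Finset.univ_nonempty q) ⁻¹'
      {v | M.γ * (E + C) < σ * (M.optValueToGo α (n + 1) s - v)} ⊆
      ⋃ a, (Function.eval a ⁻¹'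
        {x | M.γ * (E + C) < σ * (M.ρ s a + M.γ * cvar α (M.τ a s) V - x)}) := by
    intro r hr
    obtain ⟨a, ha⟩ := exists_lt_sign_mul_sub_of_lt hσ (r := r)
      (q := fun a => M.ρ s a + M.γ * cvar α (M.τ a s) V) hr
    exact Set.mem_iUnion.2 ⟨a, ha⟩
  refine (measureReal_mono hsub).trans ((measureReal_iUnion_fintype_le _).trans ?_)
  calc _ ≤ ∑ _a : A, (q + Nb * p) := Finset.sum_le_sum fun a _ => by
        rw [← map_measureReal_apply (measurable_pi_apply a) (hset _ _),
          (measurePreserving_eval (fun a : A => (Measure.pi fun _ : Fin Nb =>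
            (M.τ a s).bind (M.sparseSamplingToGo α Nb n)).map
              fun v => M.ρ s a + M.γ * empCVaR α v) a).map_eq]
        exact haction a
    _ = Fintype.card A * (q + Nb * p) := by
        rw [Finset.sum_const, Finset.card_univ, nsmul_eq_mul]

end MDP


/-! ### Error bounds for sparse sampling -/

theorem sum_range_sub_eq (m : ℕ) :
    ∑ k ∈ Finset.range m, ((m : ℝ) - k) = ∑ k ∈ Finset.range (m + 1), (k : ℝ) := by
  induction m with
  | zero => simp
  | succ m ih =>
    rw [Finset.sum_range_succ', Finset.sum_range_succ, ← ih]
    simp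

/-- Termwise, since `1 / α ^ k ≥ 1`. The cases `d = m` and `d = m + 1` give the sums of the two
error bounds. -/
theorem sum_range_sub_le_sum_div_pow {α : ℝ} (hα₀ : 0 < α) (hα₁ : α ≤ 1) (m : ℕ) {d : ℝ}
    (hd : (m : ℝ) ≤ d) :
    ∑ k ∈ Finset.range (m + 1), (k : ℝ) ≤ ∑ k ∈ Finset.range m, (d - k) / α ^ k := by
  rw [← sum_range_sub_eq]
  refine Finset.sum_le_sum fun k hk => ?_
  have hk' : (k : ℝ) ≤ m := by exact_mod_cast (Finset.mem_range.1 hk).le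
  rw [le_div_iff₀ (pow_pos hα₀ k)]
  calc ((m : ℝ) - k) * α ^ k ≤ (m - k) * 1 :=
        mul_le_mul_of_nonneg_left (pow_le_one₀ hα₀.le hα₁) (by linarith)
    _ ≤ d - k := by linarith

namespace MDP

variable {S A : Type*} [MeasurableSpace S] [Fintype A] [Nonempty A] {M : MDP S A}
  {Rmin Rmax α : ℝ} {Nb : ℕ}

/-- If at every stage the `CVaR` estimator has one-sided error at most `c` times the range of the
values, up to probability `q`, then sparse sampling with `m + 1` stages to go has one-sided error
at most `γ (Rmax - Rmin) c (1 + ⋯ + m)`, up to `q` times the number of estimator calls. -/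
theorem IsBounded.measure_error_le (hM : M.IsBounded Rmin Rmax) (hα₀ : 0 < α) (hα₁ : α ≤ 1)
    (hNb : Nb ≠ 0) {σ : ℝ} (hσ : σ = 1 ∨ σ = -1) {c q : ℝ} (hc : 0 ≤ c) (hq : 0 ≤ q)
    (hconc : ∀ n s a, (Measure.pi fun _ : Fin Nb => M.τ a s).real
      {w | n * (Rmax - Rmin) * c < σ * (cvar α (M.τ a s) (M.optValueToGo α n) -
        empCVaR α fun i => M.optValueToGo α n (w i))} ≤ q) (m : ℕ) (s : S) :
    (M.sparseSamplingToGo α Nb (m + 1) s).real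
      {v | M.γ * (Rmax - Rmin) * c * ∑ k ∈ Finset.range (m + 1), (k : ℝ) <
        σ * (M.optValueToGo α (m + 1) s - v)} ≤
      q * (Fintype.card A * ∑ i ∈ Finset.range m, ((Fintype.card A : ℝ) * Nb) ^ i) := by
  have hR := sub_nonneg.2 hM.le
  induction m generalizing s with
  | zero =>
    have hmk := hM.markov
    -- With one stage to go all successor values and their estimates are `0`, so neither error nor
    -- failure probability arises.
    have h := hM.measure_error_succ_le hα₀ hα₁ hNb hσ (n := 0) (E := 0) (C := 0) (p := 0) (q := 0)
      le_rfl (fun s => ?_) (fun s a => ?_) s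
    · simpa using h
    · have hset : MeasurableSet {v : ℝ | 0 < σ * (0 - v)} :=
        measurableSet_lt measurable_const ((measurable_const.sub measurable_id).const_mul σ)
      change (Measure.dirac (0 : ℝ) {v : ℝ | 0 < σ * (0 - v)}).toReal ≤ 0
      rw [Measure.dirac_apply' _ hset]
      simp
    · have h1 : cvar α (M.τ a s) (M.optValueToGo α 0) = 0 := cvar_const hα₀ hα₁ 0
      have h2 : ∀ w : Fin Nb → S, empCVaR α (fun i => M.optValueToGo α 0 (w i)) = 0 := fun w => by
        have := isProbabilityMeasure_uniform hNb
        rw [empCVaR_eq_cvar]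
        exact cvar_const hα₀ hα₁ 0
      simp [h1, h2]
  | succ m ih =>
    set Q := ∑ k ∈ Finset.range (m + 1), (k : ℝ) with hQ
    have hQ₀ : 0 ≤ Q := Finset.sum_nonneg fun k _ => k.cast_nonneg
    have hG₀ : 0 ≤ ∑ i ∈ Finset.range m, ((Fintype.card A : ℝ) * Nb) ^ i :=
      Finset.sum_nonneg fun i _ => by positivity
    have h := hM.measure_error_succ_le hα₀ hα₁ hNb hσ (n := m + 1)
      (mul_nonneg hq (mul_nonneg (Nat.cast_nonneg _) hG₀)) ih (hconc (m + 1)) s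
    refine (measureReal_mono ?_ ?_).trans (h.trans_eq ?_)
    · intro v hv
      rw [Set.mem_ofPred_eq] at hv ⊢
      refine lt_of_le_of_lt ?_ hv
      have hE : 0 ≤ M.γ * (Rmax - Rmin) * c * Q :=
        mul_nonneg (mul_nonneg (mul_nonneg hM.γ_nonneg hR) hc) hQ₀
      -- The error `E` already carries a factor `γ`. The second one is dropped, which leaves a
      -- single `γ` in the final bound.
      have h1 := mul_le_of_le_one_left hE hM.γ_le_one
      rw [Finset.sum_range_succ, ← hQ]
      linarith
    · have := (hM.sparseSamplingToGo (α := α) Nb (m + 1 + 1)).2 s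
      finiteness
    · rw [geom_sum_succ]
      ring

theorem IsBounded.one_sub_le_measure_error_le (hM : M.IsBounded Rmin Rmax) (hα₀ : 0 < α)
    (hα₁ : α ≤ 1) (hNb : Nb ≠ 0) {σ : ℝ} (hσ : σ = 1 ∨ σ = -1) {c q : ℝ} (hc : 0 ≤ c) (hq : 0 ≤ q)
    (hconc : ∀ n s a, (Measure.pi fun _ : Fin Nb => M.τ a s).real
      {w | n * (Rmax - Rmin) * c < σ * (cvar α (M.τ a s) (M.optValueToGo α n) -
        empCVaR α fun i => M.optValueToGo α n (w i))} ≤ q) (m : ℕ) (s : S) {δ d : ℝ}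
    (hδ : q * (Fintype.card A * ∑ i ∈ Finset.range m, ((Fintype.card A : ℝ) * Nb) ^ i) ≤ δ)
    (hd : (m : ℝ) ≤ d) :
    1 - δ ≤ (M.sparseSamplingToGo α Nb (m + 1) s).real
      {v | σ * (M.optValueToGo α (m + 1) s - v) ≤
        M.γ * (Rmax - Rmin) * c * ∑ k ∈ Finset.range m, (d - k) / α ^ k} := by
  have := (hM.sparseSamplingToGo (α := α) Nb (m + 1)).2 s
  have h := (hM.measure_error_le hα₀ hα₁ hNb hσ hc hq hconc m s).trans hδ
  have hset : MeasurableSet {v : ℝ | M.γ * (Rmax - Rmin) * c * ∑ k ∈ Finset.range (m + 1), (k : ℝ) <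
      σ * (M.optValueToGo α (m + 1) s - v)} :=
    measurableSet_lt measurable_const ((measurable_const.sub measurable_id).const_mul σ)
  calc 1 - δ ≤ _ := sub_le_sub_left h 1
    _ = _ := (probReal_compl_eq_one_sub hset).symm
    _ ≤ _ := measureReal_mono fun v hv => by
      rw [Set.mem_compl_iff, Set.mem_ofPred_eq, not_lt] at hv
      exact hv.trans (mul_le_mul_of_nonneg_left (sum_range_sub_le_sum_div_pow hα₀ hα₁ m hd)
        (mul_nonneg (mul_nonneg hM.γ_nonneg (sub_nonneg.2 hM.le)) hc))

/-- A number `N` bounding the number of estimator calls gives a nonnegative logarithm and the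
right total failure probability. -/
theorem log_nonneg_and_exp_mul_le {m : ℕ} {N δ b : ℝ} (hδ₀ : 0 < δ) (hδ₁ : δ < 1) (hb : 1 ≤ b)
    (hN : Fintype.card A * ∑ i ∈ Finset.range m, ((Fintype.card A : ℝ) * Nb) ^ i ≤ N)
    (hN₀ : m = 0 → N = 0) :
    0 ≤ Real.log (b * N / δ) ∧ b * Real.exp (-Real.log (b * N / δ)) *
      (Fintype.card A * ∑ i ∈ Finset.range m, ((Fintype.card A : ℝ) * Nb) ^ i) ≤ δ := by
  rcases Nat.eq_zero_or_pos m with rfl | hm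
  -- Here `Real.log 0 = 0` and the sum is empty: both claims are trivial.
  · simp [hN₀ rfl, hδ₀.le]
  · have hA : (1 : ℝ) ≤ Fintype.card A := by exact_mod_cast Fintype.card_pos
    have h1 : 1 ≤ ∑ i ∈ Finset.range m, ((Fintype.card A : ℝ) * Nb) ^ i := by
      have := Finset.single_le_sum (f := fun i => ((Fintype.card A : ℝ) * Nb) ^ i)
        (fun i _ => by positivity) (Finset.mem_range.2 hm)
      simpa using this
    have hN1 : 1 ≤ N := (one_le_mul_of_one_le_of_one_le hA h1).trans hN
    have hpos : 0 < b * N / δ := by positivity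
    refine ⟨Real.log_nonneg ?_, ?_⟩
    · rw [le_div_iff₀ hδ₀]
      nlinarith
    · rw [Real.exp_neg, Real.exp_log hpos]
      refine (mul_le_mul_of_nonneg_left hN (by positivity)).trans_eq ?_
      field_simp

/-- `N` is any bound on the number of estimator calls that can err. With `L = log (3 * N / δ)`, each
fails with probability at most `3 * exp (-L) = δ / N` when `N > 0`. -/
theorem IsBounded.one_sub_le_measure_underestimate (hM : M.IsBounded Rmin Rmax) (hα₀ : 0 < α)
    (hα₁ : α ≤ 1) (hNb : Nb ≠ 0) {δ N : ℝ} (hδ₀ : 0 < δ) (hδ₁ : δ < 1) {m : ℕ} (s : S)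
    (hN : Fintype.card A * ∑ i ∈ Finset.range m, ((Fintype.card A : ℝ) * Nb) ^ i ≤ N)
    (hN₀ : m = 0 → N = 0) {d : ℝ} (hd : (m : ℝ) ≤ d) :
    1 - δ ≤ (M.sparseSamplingToGo α Nb (m + 1) s).real
      {v | M.optValueToGo α (m + 1) s - v ≤ M.γ * (Rmax - Rmin) *
        (∑ k ∈ Finset.range m, (d - k) / α ^ k) *
          √(5 * Real.log (3 * N / δ) / (α * Nb))} := by
  obtain ⟨hL, hq⟩ := log_nonneg_and_exp_mul_le (A := A) (b := 3) hδ₀ hδ₁ (by norm_num) hN hN₀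
  have hmk := hM.markov
  refine (hM.one_sub_le_measure_error_le hα₀ hα₁ hNb (Or.inl rfl)
    (Real.sqrt_nonneg (5 * Real.log (3 * N / δ) / (α * Nb))) (by positivity) (fun n s a => ?_)
    m s hq hd).trans_eq ?_
  · obtain ⟨hVm, lo, hlo⟩ := hM.optValueToGo hα₀ hα₁ n
    have h := measure_cvar_sub_empCVaR_gt_le (μ := M.τ a s) hNb hα₀ hα₁ hVm hlo hL
    simpa only [add_sub_cancel_left, one_mul] using h
  · congr 1
    ext v
    rw [Set.mem_ofPred_eq, Set.mem_ofPred_eq, one_mul, mul_right_comm]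

theorem IsBounded.one_sub_le_measure_overestimate (hM : M.IsBounded Rmin Rmax) (hα₀ : 0 < α)
    (hα₁ : α ≤ 1) (hNb : Nb ≠ 0) {δ N : ℝ} (hδ₀ : 0 < δ) (hδ₁ : δ < 1) {m : ℕ} (s : S)
    (hN : Fintype.card A * ∑ i ∈ Finset.range m, ((Fintype.card A : ℝ) * Nb) ^ i ≤ N)
    (hN₀ : m = 0 → N = 0) {d : ℝ} (hd : (m : ℝ) ≤ d) :
    1 - δ ≤ (M.sparseSamplingToGo α Nb (m + 1) s).real
      {v | M.optValueToGo α (m + 1) s - v ≥ -(M.γ * (Rmax - Rmin) / α) *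
        √(Real.log (N / δ) / (2 * Nb)) * ∑ k ∈ Finset.range m, (d - k) / α ^ k} := by
  obtain ⟨hL, hq⟩ := log_nonneg_and_exp_mul_le (A := A) (b := 1) hδ₀ hδ₁ le_rfl hN hN₀
  rw [one_mul] at hL hq
  rw [one_mul] at hq
  have hmk := hM.markov
  refine (hM.one_sub_le_measure_error_le hα₀ hα₁ hNb (Or.inr rfl)
    (div_nonneg (Real.sqrt_nonneg (Real.log (N / δ) / (2 * Nb))) hα₀.le) (Real.exp_nonneg _)
    (fun n s a => ?_) m s hq hd).trans_eq ?_
  · obtain ⟨hVm, lo, hlo⟩ := hM.optValueToGo hα₀ hα₁ n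
    have h := measure_empCVaR_sub_cvar_gt_le (μ := M.τ a s) hNb hα₀ hα₁ hVm hlo hL
    simp only [add_sub_cancel_left] at h
    refine le_of_eq_of_le ?_ h
    congr 1
    ext w
    rw [Set.mem_ofPred_eq, Set.mem_ofPred_eq, neg_one_mul, neg_sub, mul_div_assoc',
      div_mul_eq_mul_div]
  · congr 1
    ext v
    rw [Set.mem_ofPred_eq, Set.mem_ofPred_eq, ge_iff_le, ← neg_le_neg_iff, neg_mul, one_mul,
      neg_neg]
    refine Eq.to_iff ?_
    congr 1
    ring

end MDP

/-! ### The particle belief MDP -/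

/-- Almost sure survival of a positive weight is what keeps the mass of the transition law at one
after restriction to particle beliefs. The costs are convex combinations of state costs. -/
theorem POMDP.isBounded_particleMDP {X A Z : Type*} [MeasurableSpace X] [MeasurableSpace Z]
    [Fintype A] [Nonempty A] (M : POMDP X A Z) (hγ₀ : 0 ≤ M.γ) (hγ₁ : M.γ ≤ 1) {Rmin Rmax : ℝ}
    (hcost : ∀ x a, Rmin ≤ M.cost x a ∧ M.cost x a ≤ Rmax) {Np : ℕ}
    (hpf : ∀ (a : A) (b : ParticleBelief X Np), ∀ᵐ b' ∂(M.genPF a b), ∃ i, 0 < (b' i).2)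
    (hne : Nonempty (ParticleBelief X Np)) : (M.particleMDP Np).IsBounded Rmin Rmax where
  markov a := by
    refine ⟨fun b => ⟨?_⟩⟩
    have h1 : IsProbabilityMeasure (M.genPF a b) := by
      have := M.markov_trans a
      have := M.isProbabilityMeasure_obsLaw a b
      refine Measure.isProbabilityMeasure_map (Measurable.aemeasurable ?_)
      refine measurable_pi_lambda _ fun i => ?_
      have h2 : Measurable fun q : Z × (Fin Np → X) => q.2 i :=
        (measurable_pi_apply i).comp measurable_snd
      exact h2.prodMk (measurable_const.mul
        ((M.measurable_obsDens a).comp (h2.prodMk measurable_fst)))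
    change Kernel.comapRight ⟨fun b => M.genPF a b, M.measurable_genPF a⟩
      (MeasurableEmbedding.subtype_coe measurableSet_particleBelief) b Set.univ = 1
    rw [Kernel.comapRight_apply' _ _ _ MeasurableSet.univ, Set.image_univ, Subtype.range_coe]
    change M.genPF a b {b | ∃ i, 0 < (b i).2} = 1
    rw [← mem_ae_iff_prob_eq_one measurableSet_particleBelief]
    exact hpf a b
  measurable_cost a := by
    have hw : ∀ i, Measurable fun b : ParticleBelief X Np => ((b.1 i).2 : ℝ) := fun i =>
      (measurable_snd.comp ((measurable_pi_apply i).comp measurable_subtype_coe)).coe_nnreal_real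
    have hx : ∀ i, Measurable fun b : ParticleBelief X Np => (b.1 i).1 := fun i =>
      measurable_fst.comp ((measurable_pi_apply i).comp measurable_subtype_coe)
    exact (Finset.measurable_sum _ fun i _ =>
      (hw i).mul ((M.measurable_cost a).comp (hx i))).div (Finset.measurable_sum _ fun i _ => hw i)
  cost_mem b a := by
    have hpos : 0 < ∑ i, ((b.1 i).2 : ℝ) := by
      obtain ⟨i, hi⟩ := b.2
      exact Finset.sum_pos' (fun j _ => NNReal.coe_nonneg _) ⟨i, Finset.mem_univ i, hi⟩
    change (∑ i, ((b.1 i).2 : ℝ) * M.cost (b.1 i).1 a) / ∑ i, ((b.1 i).2 : ℝ) ∈ Set.Icc Rmin Rmax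
    rw [Set.mem_Icc, le_div_iff₀ hpos, div_le_iff₀ hpos, Finset.mul_sum, Finset.mul_sum]
    refine ⟨Finset.sum_le_sum fun i _ => ?_, Finset.sum_le_sum fun i _ => ?_⟩
    · rw [mul_comm]
      exact mul_le_mul_of_nonneg_left (hcost _ a).1 (NNReal.coe_nonneg _)
    · rw [mul_comm Rmax]
      exact mul_le_mul_of_nonneg_left (hcost _ a).2 (NNReal.coe_nonneg _)
  le := by
    obtain ⟨i, -⟩ := hne.some.2
    obtain ⟨a⟩ := ‹Nonempty A›
    exact (hcost (hne.some.1 i).1 a).1.trans (hcost (hne.some.1 i).1 a).2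
  γ_nonneg := hγ₀
  γ_le_one := hγ₁

/-- For `Nb = 1` the ratio may be `1`, where the closed form of the geometric sum breaks down. Each
term is bounded by the largest instead. -/
theorem sum_range_pow_le_mul_pow {x : ℝ} (hx : 1 ≤ x) (m : ℕ) :
    x * ∑ i ∈ Finset.range m, x ^ i ≤ x ^ m * m := by
  rw [Finset.mul_sum]
  calc ∑ i ∈ Finset.range m, x * x ^ i ≤ ∑ _i ∈ Finset.range m, x ^ m :=
        Finset.sum_le_sum fun i hi => by
          rw [← pow_succ']
          exact pow_le_pow_right₀ hx (Finset.mem_range.1 hi)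
    _ = x ^ m * m := by simp [mul_comm]

end ICVaR

theorem theorem2 {X A Z : Type*} [MeasurableSpace X] [MeasurableSpace Z] [Fintype A] [Nonempty A]
    (M : ICVaR.POMDP X A Z) (hγ₀ : 0 ≤ M.γ) (hγ₁ : M.γ ≤ 1)
    (Rmin Rmax : ℝ) (hcost : ∀ x a, Rmin ≤ M.cost x a ∧ M.cost x a ≤ Rmax)
    (Np : ℕ)
    -- the particle filter step almost surely leaves some particle with positive weight
    (hpf : ∀ (a : A) (b : ICVaR.ParticleBelief X Np), ∀ᵐ b' ∂(M.genPF a b), ∃ i, 0 < (b' i).2)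
    (α : ℝ) (hα₀ : 0 < α) (hα₁ : α ≤ 1) (δ : ℝ) (hδ₀ : 0 < δ) (hδ₁ : δ < 1)
    (T t : ℕ) (htT : t ≤ T) (Nb : ℕ) (b : ICVaR.ParticleBelief X Np) :
    let V : ℝ := (M.particleMDP Np).optValue α T t b
    let P : Measure ℝ := (M.particleMDP Np).sparseSampling α Nb T t b
    let ΔR : ℝ := Rmax - Rmin
    let cA : ℝ := (Fintype.card A : ℝ)
    let Tα : ℝ := ∑ k ∈ Finset.range (T - t), ((T : ℝ) - t - k) / α ^ k
    let Tα' : ℝ := ∑ j ∈ Finset.range (T - t), ((T : ℝ) - t + 1 - j) / α ^ j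
    (1 < Nb →
      1 - δ ≤ P.real {v | V - v ≤ M.γ * ΔR * Tα *
        √(5 * Real.log (3 * cA * ((cA * Nb) ^ (T - t) - 1) / (δ * (cA * Nb - 1))) / (α * Nb))} ∧
      1 - δ ≤ P.real {v | V - v ≥ -(M.γ * ΔR / α) *
        √(Real.log (cA * ((cA * Nb) ^ (T - t) - 1) / (δ * (cA * Nb - 1))) / (2 * Nb)) * Tα'}) ∧
    (Nb = 1 →
      1 - δ ≤ P.real {v | V - v ≤ M.γ * ΔR * Tα *
        √(5 * Real.log (3 * cA ^ (T - t) * ((T : ℝ) - t) / δ) / α)} ∧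
      1 - δ ≤ P.real {v | V - v ≥ -(M.γ * ΔR / α) *
        √(Real.log (cA ^ (T - t) * ((T : ℝ) - t) / δ) / 2) * Tα'}) := by
  intro V P ΔR cA Tα Tα'
  have hM := M.isBounded_particleMDP hγ₀ hγ₁ hcost hpf ⟨b⟩
  have hcA : 1 ≤ cA := Nat.one_le_cast.2 Fintype.card_pos
  -- The stages `t, …, T` number `T - t + 1`. The last is exact, so `m = T - t` below.
  have hT : T + 1 - t = (T - t) + 1 := by omega
  have hm : ((T - t : ℕ) : ℝ) = (T : ℝ) - t := Nat.cast_sub htT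
  have hV : V = (M.particleMDP Np).optValueToGo α (T - t + 1) b := by
    simp only [V, ICVaR.MDP.optValue, hT]
  have hP : P = (M.particleMDP Np).sparseSamplingToGo α Nb (T - t + 1) b := by
    simp only [P, ICVaR.MDP.sparseSampling, hT]
  rw [hV, hP]
  refine ⟨fun hNb => ?_, fun hNb => ?_⟩
  · have hr : 1 < cA * Nb := by
      have : (1 : ℝ) < Nb := by exact_mod_cast hNb
      nlinarith
    have hN : cA * ∑ i ∈ Finset.range (T - t), (cA * Nb) ^ i ≤
        cA * ((cA * Nb) ^ (T - t) - 1) / (cA * Nb - 1) := by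
      rw [geom_sum_eq hr.ne', mul_div_assoc]
    have hN₀ : T - t = 0 → cA * ((cA * Nb) ^ (T - t) - 1) / (cA * Nb - 1) = 0 := fun h => by
      simp [h]
    constructor
    · have h := hM.one_sub_le_measure_underestimate hα₀ hα₁ (by omega) hδ₀ hδ₁ b hN hN₀ hm.le
      have e : 3 * (cA * ((cA * Nb) ^ (T - t) - 1) / (cA * Nb - 1)) / δ =
          3 * cA * ((cA * Nb) ^ (T - t) - 1) / (δ * (cA * Nb - 1)) := by
        rw [mul_div_assoc', div_div, mul_comm δ, mul_assoc]
      rw [e] at h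
      exact h
    · have h := hM.one_sub_le_measure_overestimate hα₀ hα₁ (by omega) hδ₀ hδ₁ b hN hN₀
        (d := (T : ℝ) - t + 1) (by linarith)
      have e : cA * ((cA * Nb) ^ (T - t) - 1) / (cA * Nb - 1) / δ =
          cA * ((cA * Nb) ^ (T - t) - 1) / (δ * (cA * Nb - 1)) := by
        rw [div_div, mul_comm δ]
      rw [e] at h
      exact h
  · subst hNb
    have hN : cA * ∑ i ∈ Finset.range (T - t), (cA * (1 : ℕ)) ^ i ≤
        cA ^ (T - t) * ((T : ℝ) - t) := by
      rw [← hm, Nat.cast_one, mul_one]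
      exact ICVaR.sum_range_pow_le_mul_pow hcA _
    have hN₀ : T - t = 0 → cA ^ (T - t) * ((T : ℝ) - t) = 0 := fun h => by
      rw [← hm, h]; simp
    constructor
    · have h := hM.one_sub_le_measure_underestimate hα₀ hα₁ one_ne_zero hδ₀ hδ₁ b hN hN₀ hm.le
      rw [Nat.cast_one, mul_one, ← mul_assoc] at h
      exact h
    · have h := hM.one_sub_le_measure_overestimate hα₀ hα₁ one_ne_zero hδ₀ hδ₁ b hN hN₀
        (d := (T : ℝ) - t + 1) (by linarith)
      rw [Nat.cast_one, mul_one] at h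
      exact h
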